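/- Let $G$ be a countable discrete group, $X$ a locally compact Hausdorff space, and let $h=(\{X_t\}_{t\in G},\{h_t\}_{t\in G})$ be a partial action of $G$ on $X$: each $X_t\subseteq X$ is open, each $h_t:X_{t^{-1}}\to X_t$ is a homeomorphism, $X_e=X$, $h_e=\mathrm{id}_X$, $h_t(X_{t^{-1}}\cap X_s)=X_t\cap X_{ts}$, and $h_t(h_s(x))=h_{ts}(x)$ for $x\in X_{s^{-1}}\cap X_{s^{-1}t^{-1}}$. Let $R\subseteq (G\times X)\times(G\times X)$, with the subspace topology, be the equivalence relation $$(r,x)\sim(s,y)\iff x\in X_{r^{-1}s}\ \text{ and }\ h_{s^{-1}r}(x)=y .$$ Make $C_c(R)$ a $*$-algebra by $(f*g)(a,c)=\sum_{b\sim a}f(a,b)g(b,c)$ and $f^*(a,b)=\overline{f(b,a)}$, and put $\|f\|_I=\max\{\sup_a\sum_{b\sim a}|f(a,b)|,\ \sup_a\sum_{b\sim a}|f(b,a)|\}$. The full groupoid C*-algebra $C^*(R)$ is the Hausdorff completion of $C_c(R)$ for the seminorm $f\mapsto\sup_\pi\|\pi(f)\|$, where $\pi$ runs over the $*$-representations of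 $C_c(R)$ on Hilbert spaces with $\|\pi(f)\|\le\|f\|_I$ for all $f$. Let $B=(B_t)_{t\in G}$, $B_t=C_0(X_t)\delta_t$, be the Fell bundle of the partial action: $C_0(X_t)=\{f\in C_0(X): f=0 \text{ off } X_t\}$, $\|a\delta_t\|=\|a\|_\infty$, $(a\delta_r)(b\delta_s)=\alpha_r(\alpha_{r^{-1}}(a)b)\delta_{rs}$ and $(a\delta_t)^*=\alpha_{t^{-1}}(\overline a)\delta_{t^{-1}}$, where $\alpha_t:C_0(X_{t^{-1}})\to C_0(X_t)$, $\alpha_t(f)=f\circ h_t^{-1}$. Let $k_c(B)$ be the $*$-algebra of all finitely supported $k:G\times G\to B$ with $k(r,s)\in B_{rs^{-1}}$, with the pointwise linear structure, $$(k_1*k_2)(r,s)=\sum_{t\in G}k_1(r,t)k_2(t,s),\qquad k^*(r,s)=k(s,r)^*,\qquad \|k\|=\Big(\sum_{r,s\in G}\|k(r,s)\|^2\Big)^{1/2}.$$ The envelope C*-algebra $k(B)$ is the universal (enveloping) C*-algebra of the Banach $*$-algebra obtained by completing $k_c(B)$ in this norm, that is, the Hausdorff completion of that Banach $*$-algebra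 for the supremum of $\|\pi(\cdot)\|$ over all its $*$-representations $\pi$ on Hilbert spaces. Then $C^*(R)$ and $k(B)$ are isomorphic C*-algebras: there is a $*$-isomorphism $C^*(R)\cong k(B)$. -/

import Mathlib

open scoped ZeroAtInfty CompactlySupported
universe u v

set_option linter.unusedSectionVars false

section Completion

/-- The (Hausdorff) completion of a seminormed `*`-algebra. -/
def StarCompletion (A : Type u) [NonUnitalSeminormedRing A] : Type u :=
  UniformSpace.Completion A

namespace StarCompletion

variable {A : Type u} [NonUnitalSeminormedRing A]

noncomputable instance : NormedAddCommGroup (StarCompletion A) :=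
  inferInstanceAs (NormedAddCommGroup (UniformSpace.Completion A))

instance : CompleteSpace (StarCompletion A) :=
  inferInstanceAs (CompleteSpace (UniformSpace.Completion A))

noncomputable instance [NormedSpace ℂ A] : NormedSpace ℂ (StarCompletion A) :=
  inferInstanceAs (NormedSpace ℂ (UniformSpace.Completion A))

/-- The canonical map of `A` into its completion. -/
noncomputable def of : A →+ StarCompletion A :=
  (UniformSpace.Completion.toCompl : A →+ UniformSpace.Completion A)

theorem norm_of (a : A) : ‖of a‖ = ‖a‖ := UniformSpace.Completion.norm_coe a

theorem continuous_of : Continuous (of : A → StarCompletion A) :=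
  UniformSpace.Completion.continuous_coe A

theorem isDenseInducing_of : IsDenseInducing (of : A → StarCompletion A) :=
  UniformSpace.Completion.isDenseInducing_coe

theorem of_smul [NormedSpace ℂ A] (c : ℂ) (a : A) : of (c • a) = c • of a :=
  UniformSpace.Completion.coe_smul c a

theorem induction {p : StarCompletion A → Prop} (x : StarCompletion A)
    (hp : IsClosed {x | p x}) (h : ∀ a : A, p (of a)) : p x :=
  UniformSpace.Completion.induction_on x hp h

theorem induction₂ {p : StarCompletion A → StarCompletion A → Prop} (x y : StarCompletion A)
    (hp : IsClosed {x : StarCompletion A × StarCompletion A | p x.1 x.2})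
    (h : ∀ a b : A, p (of a) (of b)) : p x y :=
  UniformSpace.Completion.induction_on₂ x y hp h

theorem induction₃ {p : StarCompletion A → StarCompletion A → StarCompletion A → Prop}
    (x y z : StarCompletion A)
    (hp : IsClosed {x : StarCompletion A × StarCompletion A × StarCompletion A |
      p x.1 x.2.1 x.2.2})
    (h : ∀ a b c : A, p (of a) (of b) (of c)) : p x y z :=
  UniformSpace.Completion.induction_on₃ x y z hp h

/-- The multiplication of `A`, extended by continuity. -/
noncomputable instance : Mul (StarCompletion A) :=
  ⟨fun x y => (isDenseInducing_of.prodMap isDenseInducing_of).extend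
    (fun p : A × A => (of (p.1 * p.2) : StarCompletion A)) (x, y)⟩

theorem of_mul (a b : A) : of (a * b) = (of a * of b : StarCompletion A) :=
  ((isDenseInducing_of.prodMap isDenseInducing_of).extend_eq
    (f := fun p : A × A => (of (p.1 * p.2) : StarCompletion A))
    (continuous_of.comp continuous_mul) (a, b)).symm

instance : ContinuousMul (StarCompletion A) where
  continuous_mul := by
    let m := (AddMonoidHom.mul : A →+ A →+ A).compr₂ (of : A →+ StarCompletion A)
    have : Continuous fun p : A × A => m p.1 p.2 := continuous_of.comp continuous_mul
    have di : IsDenseInducing (of : A → StarCompletion A) := isDenseInducing_of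
    exact (di.extend_Z_bilin di this :)

noncomputable instance : NonUnitalNormedRing (StarCompletion A) where
  __ : NormedAddCommGroup (StarCompletion A) := inferInstance
  __ : Mul (StarCompletion A) := inferInstance
  zero_mul x := by
    induction x using induction with
    | hp => exact isClosed_eq (by fun_prop) (by fun_prop)
    | h a =>
      rw [← map_zero of, ← of_mul, zero_mul]
  mul_zero x := by
    induction x using induction with
    | hp => exact isClosed_eq (by fun_prop) (by fun_prop)
    | h a =>
      rw [← map_zero of, ← of_mul, mul_zero]
  left_distrib x y z := by
    induction x, y, z using induction₃ with
    | hp => exact isClosed_eq (by fun_prop) (by fun_prop)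
    | h a b c =>
      simp only [← map_add, ← of_mul, mul_add]
  right_distrib x y z := by
    induction x, y, z using induction₃ with
    | hp => exact isClosed_eq (by fun_prop) (by fun_prop)
    | h a b c =>
      simp only [← map_add, ← of_mul, add_mul]
  mul_assoc x y z := by
    induction x, y, z using induction₃ with
    | hp => exact isClosed_eq (by fun_prop) (by fun_prop)
    | h a b c =>
      simp only [← of_mul, mul_assoc]
  norm_mul_le x y := by
    induction x, y using induction₂ with
    | hp => exact isClosed_le (by fun_prop) (by fun_prop)
    | h a b =>
      simpa only [← of_mul, norm_of] using norm_mul_le a b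

instance [NormedSpace ℂ A] [IsScalarTower ℂ A A] :
    IsScalarTower ℂ (StarCompletion A) (StarCompletion A) where
  smul_assoc c x y := by
    simp only [smul_eq_mul]
    induction x, y using induction₂ with
    | hp =>
      exact isClosed_eq ((continuous_fst.const_smul c).mul continuous_snd)
        ((continuous_fst.mul continuous_snd).const_smul c)
    | h a b =>
      simp only [← of_mul, ← of_smul, smul_mul_assoc]

instance [NormedSpace ℂ A] [SMulCommClass ℂ A A] :
    SMulCommClass ℂ (StarCompletion A) (StarCompletion A) where
  smul_comm c x y := by
    simp only [smul_eq_mul]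
    induction x, y using induction₂ with
    | hp =>
      exact isClosed_eq ((continuous_fst.mul continuous_snd).const_smul c)
        (continuous_fst.mul (continuous_snd.const_smul c))
    | h a b =>
      simp only [← of_mul, ← of_smul, mul_smul_comm]

variable [StarRing A] [NormedStarGroup A]

/-- The involution of `A`, extended by continuity. -/
noncomputable instance : Star (StarCompletion A) :=
  ⟨UniformSpace.Completion.map (star : A → A)⟩

theorem of_star (a : A) : of (star a) = (star (of a) : StarCompletion A) :=
  (UniformSpace.Completion.map_coe (f := (star : A → A)) star_isometry.uniformContinuous a).symm

instance : ContinuousStar (StarCompletion A) where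
  continuous_star := UniformSpace.Completion.continuous_map

noncomputable instance : StarRing (StarCompletion A) where
  star_involutive x := by
    induction x using induction with
    | hp => exact isClosed_eq (by fun_prop) (by fun_prop)
    | h a =>
      simp only [← of_star, star_star]
  star_mul x y := by
    induction x, y using induction₂ with
    | hp => exact isClosed_eq (by fun_prop) (by fun_prop)
    | h a b =>
      simp only [← of_star, ← of_mul, star_mul]
  star_add x y := by
    induction x, y using induction₂ with
    | hp => exact isClosed_eq (by fun_prop) (by fun_prop)
    | h a b =>
      simp only [← of_star, ← map_add, star_add]

instance : NormedStarGroup (StarCompletion A) where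
  norm_star_le x := by
    induction x using induction with
    | hp => exact isClosed_le (by fun_prop) (by fun_prop)
    | h a =>
      simp only [← of_star, norm_of, norm_star, le_refl]

instance [NormedSpace ℂ A] [StarModule ℂ A] : StarModule ℂ (StarCompletion A) where
  star_smul c x := by
    induction x using induction with
    | hp =>
      exact isClosed_eq (continuous_star.comp (continuous_id.const_smul c)) (continuous_star.const_smul (star c))
    | h a =>
      simp only [← of_star, ← of_smul, star_smul]

end StarCompletion

end Completion

section Envelope

/-- A representation of a complex `*`-algebra `A` on a Hilbert space. -/
structure HilbertRep (A : Type u) [NonUnitalRing A] [StarRing A] [Module ℂ A] where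
  /-- the Hilbert space -/
  H : Type u
  [normed : NormedAddCommGroup H]
  [inner : InnerProductSpace ℂ H]
  [complete : CompleteSpace H]
  /-- the representation -/
  toHom : A →⋆ₙₐ[ℂ] (H →L[ℂ] H)

attribute [instance] HilbertRep.normed HilbertRep.inner HilbertRep.complete

variable {A : Type u} [NonUnitalRing A] [StarRing A] [Module ℂ A]

/-- `A`, to be equipped with the seminorm `a ↦ sup {‖π a‖ : π ∈ S}`. -/
def WithRepNorm (_S : Set (HilbertRep A)) : Type u := A

/-- A set of representations that is pointwise bounded, so that the supremum exists. -/
class PointwiseBounded (S : Set (HilbertRep A)) : Prop where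
  bdd : ∀ a : A, BddAbove (Set.range fun π : S => ‖π.1.toHom a‖)

namespace WithRepNorm

variable (S : Set (HilbertRep A))

instance : NonUnitalRing (WithRepNorm S) := inferInstanceAs (NonUnitalRing A)
instance : StarRing (WithRepNorm S) := inferInstanceAs (StarRing A)
instance : Module ℂ (WithRepNorm S) := inferInstanceAs (Module ℂ A)
instance [IsScalarTower ℂ A A] : IsScalarTower ℂ (WithRepNorm S) (WithRepNorm S) :=
  inferInstanceAs (IsScalarTower ℂ A A)
instance [SMulCommClass ℂ A A] : SMulCommClass ℂ (WithRepNorm S) (WithRepNorm S) :=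
  inferInstanceAs (SMulCommClass ℂ A A)
instance [StarModule ℂ A] : StarModule ℂ (WithRepNorm S) := inferInstanceAs (StarModule ℂ A)

/-- The identity map of `A`. -/
def of : A →⋆ₙₐ[ℂ] WithRepNorm S := NonUnitalStarAlgHom.id ℂ A

noncomputable instance : Norm (WithRepNorm S) where
  norm a := ⨆ π : S, ‖π.1.toHom (show A from a)‖

theorem norm_def (a : WithRepNorm S) : ‖a‖ = ⨆ π : S, ‖π.1.toHom (show A from a)‖ := rfl

theorem norm_nonneg' (a : WithRepNorm S) : 0 ≤ ‖a‖ := Real.iSup_nonneg fun _ => norm_nonneg _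

variable {S}

theorem le_norm [PointwiseBounded S] (a : WithRepNorm S) (π : S) :
    ‖π.1.toHom (show A from a)‖ ≤ ‖a‖ :=
  le_ciSup (PointwiseBounded.bdd (S := S) (show A from a)) π

theorem norm_le {a : WithRepNorm S} {c : ℝ} (hc : 0 ≤ c)
    (h : ∀ π : S, ‖π.1.toHom (show A from a)‖ ≤ c) : ‖a‖ ≤ c :=
  Real.iSup_le h hc

variable [PointwiseBounded S]

noncomputable instance : SeminormedAddCommGroup (WithRepNorm S) :=
  AddGroupSeminorm.toSeminormedAddCommGroup
    { toFun := fun a : WithRepNorm S => ‖a‖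
      map_zero' := le_antisymm (norm_le le_rfl fun π => by
        change ‖π.1.toHom 0‖ ≤ 0
        simp) (norm_nonneg' _ _)
      add_le' := fun a b => norm_le (add_nonneg (norm_nonneg' _ _) (norm_nonneg' _ _)) fun π => by
        change ‖π.1.toHom ((show A from a) + (show A from b))‖ ≤ _
        rw [map_add]
        exact (norm_add_le _ _).trans (add_le_add (le_norm a π) (le_norm b π))
      neg' := fun a => by
        change (⨆ π : S, ‖π.1.toHom (-(show A from a))‖) = ⨆ π : S, ‖π.1.toHom (show A from a)‖
        refine congrArg _ (funext fun π => ?_)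
        rw [map_neg, norm_neg] }

noncomputable instance : NonUnitalSeminormedRing (WithRepNorm S) where
  dist_eq a b := SeminormedAddCommGroup.dist_eq a b
  norm_mul_le a b := norm_le (mul_nonneg (norm_nonneg' _ _) (norm_nonneg' _ _)) fun π => by
    change ‖π.1.toHom ((show A from a) * (show A from b))‖ ≤ _
    rw [map_mul]
    exact (norm_mul_le _ _).trans
      (mul_le_mul (le_norm a π) (le_norm b π) (norm_nonneg _) (norm_nonneg' _ _))

instance : NormedStarGroup (WithRepNorm S) where
  norm_star_le a := norm_le (norm_nonneg' _ _) fun π => by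
    change ‖π.1.toHom (star (show A from a))‖ ≤ _
    rw [map_star, norm_star]
    exact le_norm a π

noncomputable instance : NormedSpace ℂ (WithRepNorm S) where
  norm_smul_le c a := norm_le (mul_nonneg (norm_nonneg _) (norm_nonneg' _ _)) fun π => by
    change ‖π.1.toHom (c • (show A from a))‖ ≤ _
    rw [map_smul, norm_smul]
    exact mul_le_mul_of_nonneg_left (le_norm a π) (norm_nonneg _)

theorem norm_mul_self_le (a : WithRepNorm S) : ‖a‖ * ‖a‖ ≤ ‖star a * a‖ := by
  have h : ‖a‖ ≤ √‖star a * a‖ := norm_le (Real.sqrt_nonneg _) fun π => by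
    refine Real.le_sqrt_of_sq_le ?_
    rw [sq, ← CStarRing.norm_star_mul_self, ← map_star, ← map_mul]
    exact le_norm (star a * a) π
  calc ‖a‖ * ‖a‖ ≤ √‖star a * a‖ * √‖star a * a‖ :=
        mul_self_le_mul_self (norm_nonneg' _ _) h
    _ = ‖star a * a‖ := Real.mul_self_sqrt (norm_nonneg' _ _)

end WithRepNorm

/-- The C*-algebra obtained from the `*`-algebra `A` by dividing out the null space of the
C*-seminorm `a ↦ sup {‖π a‖ : π ∈ S}` and completing. -/
abbrev RepCStar (S : Set (HilbertRep A)) [PointwiseBounded S] : Type u :=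
  StarCompletion (WithRepNorm S)

noncomputable instance [IsScalarTower ℂ A A] [SMulCommClass ℂ A A] [StarModule ℂ A]
    (S : Set (HilbertRep A)) [PointwiseBounded S] : NonUnitalCStarAlgebra (RepCStar S) where
  toIsScalarTower := inferInstance
  toSMulCommClass := inferInstance
  toStarModule := inferInstance
  norm_mul_self_le x := by
    induction x using StarCompletion.induction with
    | hp => exact isClosed_le (by fun_prop) (by fun_prop)
    | h a =>
      simpa only [← StarCompletion.of_star, ← StarCompletion.of_mul, StarCompletion.norm_of] using
        WithRepNorm.norm_mul_self_le a

end Envelope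

section Banach

variable {K : Type u} [NonUnitalNormedRing K] [StarRing K] [NormedStarGroup K] [CompleteSpace K]
  [NormedSpace ℂ K] [IsScalarTower ℂ K K] [SMulCommClass ℂ K K]

/-- Every representation of a Banach `*`-algebra is contractive. -/
theorem HilbertRep.norm_le_of_banach (π : HilbertRep K) (a : K) : ‖π.toHom a‖ ≤ ‖a‖ := by
  have key : ∀ b : K, IsSelfAdjoint b → ‖π.toHom b‖ ≤ ‖b‖ := by
    intro b hb
    rcases subsingleton_or_nontrivial π.H with hH | hH
    · simp [Subsingleton.elim (π.toHom b) 0]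
    let φ : Unitization ℂ K →ₐ[ℂ] (π.H →L[ℂ] π.H) := Unitization.lift (π.toHom : K →ₙₐ[ℂ] _)
    let ψ : WithLp 1 (Unitization ℂ K) →ₐ[ℂ] (π.H →L[ℂ] π.H) :=
      φ.comp (WithLp.unitizationAlgEquiv ℂ : WithLp 1 (Unitization ℂ K) ≃ₐ[ℂ] Unitization ℂ K).toAlgHom
    have hψ : ψ (WithLp.toLp 1 (b : Unitization ℂ K)) = π.toHom b := by
      change φ (b : Unitization ℂ K) = π.toHom b
      simp [φ]
      rfl
    have hsa : IsSelfAdjoint (π.toHom b) := hb.map π.toHom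
    have h1 := hsa.spectralRadius_eq_nnnorm
    have h2 : spectralRadius ℂ (π.toHom b) ≤
        spectralRadius ℂ (WithLp.toLp 1 (b : Unitization ℂ K)) := by
      rw [← hψ]
      exact iSup_le_iSup_of_subset (AlgHom.spectrum_apply_subset ψ _)
    have : NormOneClass (WithLp 1 (Unitization ℂ K)) :=
      ⟨by
        rw [WithLp.unitization_norm_def]
        change ‖(1 : Unitization ℂ K).fst‖ + ‖(1 : Unitization ℂ K).snd‖ = 1
        simp⟩
    have h3 : spectralRadius ℂ (WithLp.toLp 1 (b : Unitization ℂ K)) ≤ _ :=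
      spectrum.spectralRadius_le_nnnorm _
    have h4 := h1.symm.le.trans (h2.trans h3)
    have h5 : ‖π.toHom b‖₊ ≤ ‖WithLp.toLp 1 (b : Unitization ℂ K)‖₊ := by exact_mod_cast h4
    rw [WithLp.unitization_nnnorm_inr] at h5
    exact_mod_cast h5
  have h := key (star a * a) (.star_mul_self a)
  rw [map_mul, map_star, CStarRing.norm_star_mul_self] at h
  have h' : ‖star a * a‖ ≤ ‖a‖ * ‖a‖ := (norm_mul_le _ _).trans (by rw [norm_star])
  exact (mul_self_le_mul_self_iff (norm_nonneg _) (norm_nonneg _)).2 (h.trans h')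

instance : PointwiseBounded (Set.univ : Set (HilbertRep K)) where
  bdd a := ⟨‖a‖, by rintro _ ⟨π, rfl⟩; exact π.1.norm_le_of_banach a⟩

/-- The enveloping (universal) C*-algebra of a Banach `*`-algebra: the supremum is taken over all
representations. -/
abbrev EnvelopingCStar (K : Type u) [NonUnitalNormedRing K] [StarRing K] [NormedStarGroup K]
    [CompleteSpace K] [NormedSpace ℂ K] [IsScalarTower ℂ K K] [SMulCommClass ℂ K K] :
    Type u :=
  RepCStar (Set.univ : Set (HilbertRep K))

end Banach

section PartialAction

/-- A partial action of the group `G` on the topological space `X` by homeomorphisms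
`h t : dom t⁻¹ → dom t` between open subsets. -/
structure TopologicalPartialAction (G : Type u) (X : Type v) [Group G] [TopologicalSpace X] where
  /-- the domains `X_t` -/
  dom : G → Set X
  /-- the partial homeomorphisms; their values off their sources are irrelevant -/
  h : G → OpenPartialHomeomorph X X
  source_h : ∀ t, (h t).source = dom t⁻¹
  target_h : ∀ t, (h t).target = dom t
  dom_one : dom 1 = Set.univ
  h_one : ∀ x, h 1 x = x
  image_h : ∀ t s, h t '' (dom t⁻¹ ∩ dom s) = dom t ∩ dom (t * s)
  h_h : ∀ t s, ∀ x ∈ dom s⁻¹ ∩ dom (s⁻¹ * t⁻¹), h t (h s x) = h (t * s) x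

namespace TopologicalPartialAction

variable {G : Type u} {X : Type v} [Group G] [TopologicalSpace X]
variable (θ : TopologicalPartialAction G X)

theorem isOpen_dom (t : G) : IsOpen (θ.dom t) := θ.target_h t ▸ (θ.h t).open_target

theorem h_mem {t : G} {x : X} (hx : x ∈ θ.dom t⁻¹) : θ.h t x ∈ θ.dom t := by
  rw [← θ.target_h]
  exact (θ.h t).map_source (by rwa [θ.source_h])

theorem h_mem_mul {t s : G} {x : X} (hx : x ∈ θ.dom t⁻¹) (hx' : x ∈ θ.dom s) :
    θ.h t x ∈ θ.dom (t * s) := by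
  have : θ.h t x ∈ θ.h t '' (θ.dom t⁻¹ ∩ θ.dom s) := ⟨x, ⟨hx, hx'⟩, rfl⟩
  rw [θ.image_h] at this
  exact this.2

theorem h_inv_h {t : G} {x : X} (hx : x ∈ θ.dom t⁻¹) : θ.h t⁻¹ (θ.h t x) = x := by
  rw [θ.h_h t⁻¹ t x ⟨hx, by simp [θ.dom_one]⟩]
  simp [θ.h_one]

theorem symm_eq {t : G} {x : X} (hx : x ∈ θ.dom t) : (θ.h t).symm x = θ.h t⁻¹ x := by
  have hx' : x ∈ (θ.h t).target := by rwa [θ.target_h]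
  have h1 : (θ.h t).symm x ∈ θ.dom t⁻¹ := by
    rw [← θ.source_h]
    exact (θ.h t).map_target hx'
  have h2 := θ.h_inv_h h1
  rw [(θ.h t).right_inv hx'] at h2
  exact h2.symm

/-! ### The equivalence relation and its groupoid C*-algebra -/

/-- `(r, x) ~ (s, y)` iff `x ∈ X_{r⁻¹ s}` and `h_{s⁻¹ r} x = y`. -/
def Rel (a b : G × X) : Prop :=
  a.2 ∈ θ.dom (a.1⁻¹ * b.1) ∧ θ.h (b.1⁻¹ * a.1) a.2 = b.2

theorem rel_refl (a : G × X) : θ.Rel a a := by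
  simp [Rel, θ.dom_one, θ.h_one]

theorem rel_symm {a b : G × X} (hab : θ.Rel a b) : θ.Rel b a := by
  obtain ⟨r, x⟩ := a
  obtain ⟨s, y⟩ := b
  obtain ⟨h1, h2⟩ := hab
  dsimp only at h1 h2
  have h1' : x ∈ θ.dom (s⁻¹ * r)⁻¹ := by simpa using h1
  subst h2
  refine ⟨θ.h_mem h1', ?_⟩
  have := θ.h_inv_h h1'
  simpa using this

theorem rel_trans {a b c : G × X} (hab : θ.Rel a b) (hbc : θ.Rel b c) : θ.Rel a c := by
  have hba := θ.rel_symm hab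
  obtain ⟨r, x⟩ := a
  obtain ⟨s, y⟩ := b
  obtain ⟨u, z⟩ := c
  obtain ⟨h1, h2⟩ := hab
  obtain ⟨h3, h4⟩ := hbc
  obtain ⟨h5, h6⟩ := hba
  dsimp only at h1 h2 h3 h4 h5 h6
  have hx : x ∈ θ.dom (r⁻¹ * u) := by
    have := θ.h_mem_mul (t := r⁻¹ * s) (s := s⁻¹ * u) (x := y) (by simpa using h5) h3
    rw [h6] at this
    simpa [mul_assoc] using this
  refine ⟨hx, ?_⟩
  have := θ.h_h (u⁻¹ * s) (s⁻¹ * r) x ⟨by simpa using h1, by simpa [mul_assoc] using hx⟩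
  rw [h2, h4] at this
  simpa [mul_assoc] using this.symm

/-- The equivalence relation `R ⊆ (G × X) × (G × X)`; its topology is the subspace topology. -/
def R : Type (max u v) := {p : (G × X) × (G × X) // θ.Rel p.1 p.2}

variable [TopologicalSpace G]

instance : TopologicalSpace θ.R :=
  inferInstanceAs (TopologicalSpace {p : (G × X) × (G × X) // θ.Rel p.1 p.2})

/-- `C_c(R)`, with the convolution `*`-algebra structure given below. -/
structure ConvAlgebra where
  /-- the underlying function -/
  toCc : C_c(θ.R, ℂ)

namespace ConvAlgebra

variable {θ}

@[ext]
theorem ext' {f g : θ.ConvAlgebra} (h : f.toCc = g.toCc) : f = g := by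
  cases f; cases g; cases h; rfl

/-- The linear structure of `ConvAlgebra` is that of functions. -/
def equivCc : θ.ConvAlgebra ≃ C_c(θ.R, ℂ) := ⟨toCc, mk, fun _ => rfl, fun _ => rfl⟩

noncomputable instance : AddCommGroup θ.ConvAlgebra := equivCc.addCommGroup
noncomputable instance : Module ℂ θ.ConvAlgebra := equivCc.module ℂ

open Classical in
/-- The value `f(a, b)`, extended by zero to all pairs. -/
noncomputable def ker (f : θ.ConvAlgebra) (a b : G × X) : ℂ :=
  if hab : θ.Rel a b then f.toCc ⟨(a, b), hab⟩ else 0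

theorem ker_of_rel (f : θ.ConvAlgebra) {a b : G × X} (hab : θ.Rel a b) :
    f.ker a b = f.toCc ⟨(a, b), hab⟩ := dif_pos hab

theorem ker_of_not (f : θ.ConvAlgebra) {a b : G × X} (hab : ¬ θ.Rel a b) :
    f.ker a b = 0 := dif_neg hab

theorem ext_ker {f g : θ.ConvAlgebra} (h : ∀ a b, f.ker a b = g.ker a b) : f = g := by
  refine ext' (CompactlySupportedContinuousMap.ext fun p => ?_)
  have := h p.1.1 p.1.2
  rwa [ker_of_rel f p.2, ker_of_rel g p.2] at this

theorem ker_add (f g : θ.ConvAlgebra) (a b : G × X) : (f + g).ker a b = f.ker a b + g.ker a b := by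
  by_cases hab : θ.Rel a b
  · simp only [ker_of_rel _ hab]; rfl
  · simp [ker_of_not _ hab]

theorem ker_zero (a b : G × X) : (0 : θ.ConvAlgebra).ker a b = 0 := by
  by_cases hab : θ.Rel a b
  · simp only [ker_of_rel _ hab]; rfl
  · simp [ker_of_not _ hab]

theorem ker_smul (c : ℂ) (f : θ.ConvAlgebra) (a b : G × X) : (c • f).ker a b = c * f.ker a b := by
  by_cases hab : θ.Rel a b
  · simp only [ker_of_rel _ hab]; rfl
  · simp [ker_of_not _ hab]

variable [DiscreteTopology G]

/-- Compactly supported functions on `R` only meet finitely many of the sets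
`R ∩ (G × X) × ({t} × X)`. -/
theorem exists_finset (f : θ.ConvAlgebra) :
    ∃ T : Finset G, ∀ a b, f.ker a b ≠ 0 → b.1 ∈ T := by
  have hc : IsCompact ((fun p : θ.R => p.1.2.1) '' tsupport f.toCc) :=
    f.toCc.hasCompactSupport.isCompact.image
      (continuous_fst.comp (continuous_snd.comp continuous_subtype_val))
  refine ⟨hc.finite_of_discrete.toFinset, fun a b hab => ?_⟩
  have hr : θ.Rel a b := by
    by_contra hr
    exact hab (ker_of_not f hr)
  rw [ker_of_rel f hr] at hab
  rw [Set.Finite.mem_toFinset]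
  exact ⟨⟨(a, b), hr⟩, subset_tsupport _ hab, rfl⟩

/-- Only finitely many `b` have `f(a, b) ≠ 0`. -/
theorem finite_row (f : θ.ConvAlgebra) (a : G × X) : {b | f.ker a b ≠ 0}.Finite := by
  obtain ⟨T, hT⟩ := f.exists_finset
  refine (T.finite_toSet.image fun t => (t, θ.h (t⁻¹ * a.1) a.2)).subset fun b hb => ?_
  have hr : θ.Rel a b := by
    by_contra hr
    exact hb (ker_of_not f hr)
  exact ⟨b.1, hT a b hb, Prod.ext rfl hr.2⟩

/-- The convolution product `(f * g)(a, c) = ∑_b f(a, b) g(b, c)`. -/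
noncomputable def conv (f g : θ.ConvAlgebra) (p : θ.R) : ℂ :=
  ∑ᶠ b : G × X, f.ker p.1.1 b * g.ker b p.1.2

theorem conv_eq_sum (f g : θ.ConvAlgebra) {T : Finset G}
    (hT : ∀ a b, f.ker a b ≠ 0 → b.1 ∈ T) (p : θ.R) :
    conv f g p = ∑ t ∈ T, f.ker p.1.1 (t, θ.h (t⁻¹ * p.1.1.1) p.1.1.2) *
      g.ker (t, θ.h (t⁻¹ * p.1.1.1) p.1.1.2) p.1.2 := by
  classical
  let e : G ↪ G × X := ⟨fun t => (t, θ.h (t⁻¹ * p.1.1.1) p.1.1.2), fun s t hst => by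
    simpa using congrArg Prod.fst hst⟩
  rw [conv, finsum_eq_sum_of_support_subset (s := T.map e), Finset.sum_map]
  · rfl
  · intro b hb
    have hb' : f.ker p.1.1 b ≠ 0 := left_ne_zero_of_mul hb
    have hr : θ.Rel p.1.1 b := by
      by_contra hr
      exact hb' (ker_of_not f hr)
    rw [Finset.mem_coe, Finset.mem_map]
    exact ⟨b.1, hT _ _ hb', Prod.ext rfl hr.2⟩

theorem exists_row (f : θ.ConvAlgebra) (a : G × X) :
    ∃ B : Finset (G × X), ∀ b, f.ker a b ≠ 0 → b ∈ B :=
  ⟨(f.finite_row a).toFinset, fun b hb => by simpa using hb⟩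

variable [T2Space X]

/-- The pairs in `tsupport f × tsupport g` that are composable through a point of `{t} × X`,
composed. -/
def prodSet (f g : θ.ConvAlgebra) (t : G) : Set θ.R :=
  {p | ∃ b : G × X, b.1 = t ∧ ∃ (h1 : θ.Rel p.1.1 b) (h2 : θ.Rel b p.1.2),
    (⟨(p.1.1, b), h1⟩ : θ.R) ∈ tsupport f.toCc ∧ (⟨(b, p.1.2), h2⟩ : θ.R) ∈ tsupport g.toCc}

theorem isCompact_prodSet (f g : θ.ConvAlgebra) (t : G) : IsCompact (prodSet f g t) := by
  have hM : IsCompact ((tsupport f.toCc ×ˢ tsupport g.toCc) ∩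
      {q : θ.R × θ.R | q.1.1.2 = q.2.1.1 ∧ q.1.1.2.1 = t}) := by
    refine (f.toCc.hasCompactSupport.isCompact.prod g.toCc.hasCompactSupport.isCompact).inter_right
      (IsClosed.inter (isClosed_eq ?_ ?_) (isClosed_eq ?_ continuous_const))
    · exact continuous_snd.comp (continuous_subtype_val.comp continuous_fst)
    · exact continuous_fst.comp (continuous_subtype_val.comp continuous_snd)
    · exact continuous_fst.comp (continuous_snd.comp (continuous_subtype_val.comp continuous_fst))
  have hc : Continuous fun q : θ.R × θ.R => (q.1.1.1, q.2.1.2) :=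
    (continuous_fst.comp (continuous_subtype_val.comp continuous_fst)).prodMk
      (continuous_snd.comp (continuous_subtype_val.comp continuous_snd))
  have := hM.image hc
  refine Subtype.isCompact_iff.2 ?_
  convert this using 1
  ext ⟨a, c⟩
  constructor
  · rintro ⟨p, ⟨b, hb, h1, h2, h3, h4⟩, hp⟩
    obtain ⟨rfl, rfl⟩ := Prod.ext_iff.1 hp
    exact ⟨(⟨(_, b), h1⟩, ⟨(b, _), h2⟩), ⟨⟨h3, h4⟩, rfl, hb⟩, rfl⟩
  · rintro ⟨⟨⟨⟨a', b⟩, h1⟩, ⟨⟨b', c'⟩, h2⟩⟩, ⟨⟨h3, h4⟩, h5, h6⟩, h7⟩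
    obtain ⟨rfl, rfl⟩ := Prod.ext_iff.1 h7
    dsimp only at h5
    subst h5
    exact ⟨⟨(a', c'), θ.rel_trans h1 h2⟩, ⟨b, h6, h1, h2, h3, h4⟩, rfl⟩

theorem mem_prodSet (f g : θ.ConvAlgebra) {p : θ.R} {b : G × X}
    (h : f.ker p.1.1 b * g.ker b p.1.2 ≠ 0) : p ∈ prodSet f g b.1 := by
  have h1 := left_ne_zero_of_mul h
  have h2 := right_ne_zero_of_mul h
  have r1 : θ.Rel p.1.1 b := by
    by_contra hr
    exact h1 (ker_of_not f hr)
  have r2 : θ.Rel b p.1.2 := by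
    by_contra hr
    exact h2 (ker_of_not g hr)
  rw [ker_of_rel _ r1] at h1
  rw [ker_of_rel _ r2] at h2
  exact ⟨b, rfl, r1, r2, subset_tsupport _ h1, subset_tsupport _ h2⟩

instance : T2Space θ.R := inferInstanceAs (T2Space {p : (G × X) × (G × X) // θ.Rel p.1 p.2})

theorem continuous_term (f g : θ.ConvAlgebra) (t : G) : Continuous fun p : θ.R =>
    f.ker p.1.1 (t, θ.h (t⁻¹ * p.1.1.1) p.1.1.2) *
      g.ker (t, θ.h (t⁻¹ * p.1.1.1) p.1.1.2) p.1.2 := by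
  refine continuous_of_tsupport fun p₀ hp₀ => ?_
  have hp : p₀ ∈ prodSet f g t :=
    closure_minimal (fun p hp => mem_prodSet f g (b := (t, θ.h (t⁻¹ * p.1.1.1) p.1.1.2)) hp)
      (isCompact_prodSet f g t).isClosed hp₀
  obtain ⟨b, rfl, h1, h2, -, -⟩ := hp
  let r := p₀.1.1.1
  let U : Set θ.R := {p | p.1.1.1 = r ∧ p.1.1.2 ∈ θ.dom (r⁻¹ * b.1)}
  have c1 : Continuous fun p : θ.R => p.1.1.1 :=
    continuous_fst.comp (continuous_fst.comp continuous_subtype_val)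
  have c2 : Continuous fun p : θ.R => p.1.1.2 :=
    continuous_snd.comp (continuous_fst.comp continuous_subtype_val)
  have hU : IsOpen U := ((isOpen_discrete {r}).preimage c1).inter
    ((θ.isOpen_dom (r⁻¹ * b.1)).preimage c2)
  have hpU : p₀ ∈ U := ⟨rfl, h1.1⟩
  refine ContinuousOn.continuousAt (s := U) ?_ (hU.mem_nhds hpU)
  rw [continuousOn_iff_continuous_domRestrict]
  have hrel : ∀ p : U, θ.Rel p.1.1.1 (b.1, θ.h (b.1⁻¹ * r) p.1.1.1.2) := fun p => by
    have h3 := p.2.2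
    have h4 : p.1.1.1.1 = r := p.2.1
    refine ⟨?_, ?_⟩
    · rw [h4]; exact h3
    · rw [h4]
  have hrel' : ∀ p : U, θ.Rel (b.1, θ.h (b.1⁻¹ * r) p.1.1.1.2) p.1.1.2 := fun p =>
    θ.rel_trans (θ.rel_symm (hrel p)) p.1.2
  have ch : Continuous fun p : U => θ.h (b.1⁻¹ * r) p.1.1.1.2 := by
    refine (θ.h (b.1⁻¹ * r)).continuousOn.comp_continuous (c2.comp continuous_subtype_val) ?_
    intro p
    rw [θ.source_h]
    simpa using p.2.2
  have cb : Continuous fun p : U => ((b.1, θ.h (b.1⁻¹ * r) p.1.1.1.2) : G × X) :=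
    continuous_const.prodMk ch
  have ca : Continuous fun p : U => p.1.1.1 :=
    continuous_fst.comp (continuous_subtype_val.comp continuous_subtype_val)
  have cc : Continuous fun p : U => p.1.1.2 :=
    continuous_snd.comp (continuous_subtype_val.comp continuous_subtype_val)
  have e1 : Continuous fun p : U => f.toCc ⟨(p.1.1.1, _), hrel p⟩ :=
    f.toCc.continuous.comp ((ca.prodMk cb).subtype_mk hrel)
  have e2 : Continuous fun p : U => g.toCc ⟨(_, p.1.1.2), hrel' p⟩ :=
    g.toCc.continuous.comp ((cb.prodMk cc).subtype_mk hrel')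
  refine (e1.mul e2).congr fun p => ?_
  have h4 : p.1.1.1.1 = r := p.2.1
  rw [Set.domRestrict_apply, h4, ker_of_rel _ (hrel p), ker_of_rel _ (hrel' p)]
  rfl

/-- The product of `C_c(R)` is convolution. -/
noncomputable instance : Mul θ.ConvAlgebra where
  mul f g := ⟨{
    toFun := conv f g
    continuous_toFun := by
      obtain ⟨T, hT⟩ := f.exists_finset
      rw [show conv f g = _ from funext fun p => conv_eq_sum f g hT p]
      exact continuous_finsetSum _ fun t _ => continuous_term f g t
    hasCompactSupport' := by
      obtain ⟨T, hT⟩ := f.exists_finset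
      refine HasCompactSupport.intro (T.isCompact_biUnion fun t _ => isCompact_prodSet f g t)
        fun p hp => ?_
      rw [conv_eq_sum f g hT]
      refine Finset.sum_eq_zero fun t ht => ?_
      by_contra h
      exact hp (Set.mem_biUnion ht
        (mem_prodSet f g (b := (t, θ.h (t⁻¹ * p.1.1.1) p.1.1.2)) h)) }⟩

theorem ker_mul (f g : θ.ConvAlgebra) (a c : G × X) :
    (f * g).ker a c = ∑ᶠ b : G × X, f.ker a b * g.ker b c := by
  by_cases hac : θ.Rel a c
  · rw [ker_of_rel _ hac]; rfl
  · rw [ker_of_not _ hac, finsum_eq_zero_of_forall_eq_zero]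
    intro b
    by_contra h
    have h1 := left_ne_zero_of_mul h
    have h2 := right_ne_zero_of_mul h
    refine hac (θ.rel_trans (b := b) ?_ ?_)
    · by_contra hr
      exact h1 (ker_of_not f hr)
    · by_contra hr
      exact h2 (ker_of_not g hr)

theorem ker_mul_eq_sum (f g : θ.ConvAlgebra) (a c : G × X) {B : Finset (G × X)}
    (hB : ∀ b, f.ker a b ≠ 0 → b ∈ B) :
    (f * g).ker a c = ∑ b ∈ B, f.ker a b * g.ker b c := by
  rw [ker_mul]
  exact finsum_eq_sum_of_support_subset _ fun b hb => hB b (left_ne_zero_of_mul hb)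

noncomputable instance : NonUnitalRing θ.ConvAlgebra where
  left_distrib f g k := ext_ker fun a c => by
    obtain ⟨B, hB⟩ := f.exists_row a
    simp only [ker_mul_eq_sum _ _ a c hB, ker_add, mul_add, Finset.sum_add_distrib]
  right_distrib f g k := ext_ker fun a c => by
    classical
    obtain ⟨B, hB⟩ := f.exists_row a
    obtain ⟨B', hB'⟩ := g.exists_row a
    have h1 : ∀ b, f.ker a b ≠ 0 → b ∈ B ∪ B' := fun b hb => Finset.mem_union_left _ (hB b hb)
    have h2 : ∀ b, g.ker a b ≠ 0 → b ∈ B ∪ B' := fun b hb => Finset.mem_union_right _ (hB' b hb)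
    have h3 : ∀ b, (f + g).ker a b ≠ 0 → b ∈ B ∪ B' := fun b hb => by
      by_contra hb'
      refine hb ?_
      rw [ker_add, not_not.1 fun h => hb' (h1 b h), not_not.1 fun h => hb' (h2 b h), add_zero]
    rw [ker_mul_eq_sum _ _ a c h3, ker_add, ker_mul_eq_sum _ _ a c h1, ker_mul_eq_sum _ _ a c h2,
      ← Finset.sum_add_distrib]
    simp only [ker_add, add_mul]
  zero_mul f := ext_ker fun a c => by simp [ker_mul, ker_zero]
  mul_zero f := ext_ker fun a c => by simp [ker_mul, ker_zero]
  mul_assoc f g k := ext_ker fun a d => by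
    classical
    obtain ⟨B, hB⟩ := f.exists_row a
    choose C hC using fun b => g.exists_row b
    have h1 : ∀ c, (f * g).ker a c ≠ 0 → c ∈ B.biUnion C := fun c hc => by
      by_contra hc'
      refine hc ?_
      rw [ker_mul_eq_sum _ _ a c hB]
      refine Finset.sum_eq_zero fun b hb => ?_
      rw [not_not.1 fun h => hc' (Finset.mem_biUnion.2 ⟨b, hb, hC b c h⟩), mul_zero]
    rw [ker_mul_eq_sum _ _ a d h1, ker_mul_eq_sum _ _ a d hB]
    simp only [ker_mul_eq_sum _ _ a _ hB, Finset.sum_mul]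
    rw [Finset.sum_comm]
    refine Finset.sum_congr rfl fun b hb => ?_
    have h2 : ∀ c, g.ker b c ≠ 0 → c ∈ B.biUnion C := fun c hc =>
      Finset.mem_biUnion.2 ⟨b, hb, hC b c hc⟩
    rw [ker_mul_eq_sum _ _ b d h2, Finset.mul_sum]
    simp only [mul_assoc]

instance : IsScalarTower ℂ θ.ConvAlgebra θ.ConvAlgebra where
  smul_assoc z f g := ext_ker fun a c => by
    obtain ⟨B, hB⟩ := f.exists_row a
    have h1 : ∀ b, (z • f).ker a b ≠ 0 → b ∈ B := fun b hb => hB b <| by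
      rw [ker_smul] at hb
      exact right_ne_zero_of_mul hb
    simp only [smul_eq_mul, ker_smul, ker_mul_eq_sum _ _ a c hB, ker_mul_eq_sum _ _ a c h1,
      Finset.mul_sum, mul_assoc]

instance : SMulCommClass ℂ θ.ConvAlgebra θ.ConvAlgebra where
  smul_comm z f g := ext_ker fun a c => by
    obtain ⟨B, hB⟩ := f.exists_row a
    simp only [smul_eq_mul, ker_smul, ker_mul_eq_sum _ _ a c hB, Finset.mul_sum, mul_left_comm]

/-- The inversion `(a, b) ↦ (b, a)` of `R`. -/
def flip : θ.R ≃ₜ θ.R where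
  toFun p := ⟨(p.1.2, p.1.1), θ.rel_symm p.2⟩
  invFun p := ⟨(p.1.2, p.1.1), θ.rel_symm p.2⟩
  left_inv _ := rfl
  right_inv _ := rfl
  continuous_toFun := (continuous_swap.comp continuous_subtype_val).subtype_mk _
  continuous_invFun := (continuous_swap.comp continuous_subtype_val).subtype_mk _

/-- The involution `f*(a, b) = conj (f (b, a))`. -/
noncomputable instance : Star θ.ConvAlgebra where
  star f := ⟨{
    toFun := fun p => star (f.toCc (flip p))
    continuous_toFun := continuous_star.comp (f.toCc.continuous.comp flip.continuous)
    hasCompactSupport' :=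
      (f.toCc.hasCompactSupport.comp_homeomorph flip).comp_left (g := star) (star_zero ℂ) }⟩

theorem ker_star (f : θ.ConvAlgebra) (a b : G × X) : (star f).ker a b = star (f.ker b a) := by
  by_cases hab : θ.Rel a b
  · rw [ker_of_rel _ hab, ker_of_rel _ (θ.rel_symm hab)]; rfl
  · rw [ker_of_not _ hab, ker_of_not _ fun h => hab (θ.rel_symm h), star_zero]

noncomputable instance : StarRing θ.ConvAlgebra where
  star_involutive f := ext_ker fun a b => by simp only [ker_star, star_star]
  star_mul f g := ext_ker fun a c => by
    classical
    obtain ⟨B, hB⟩ := f.exists_row c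
    obtain ⟨B', hB'⟩ := (star g).exists_row a
    rw [ker_star, ker_mul_eq_sum f g c a fun b hb => Finset.mem_union_left B' (hB b hb),
      ker_mul_eq_sum _ _ a c fun b hb => Finset.mem_union_right B (hB' b hb), star_sum]
    simp only [star_mul, ker_star]
  star_add f g := ext_ker fun a b => by simp only [ker_star, ker_add, star_add]

instance : StarModule ℂ θ.ConvAlgebra where
  star_smul z f := ext_ker fun a b => by simp only [ker_star, ker_smul, star_mul']

/-- The `I`-norm `max (sup_a ∑_b |f(a, b)|) (sup_a ∑_b |f(b, a)|)`. -/
noncomputable def iNorm (f : θ.ConvAlgebra) : ℝ :=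
  max (⨆ a : G × X, ∑ᶠ b : G × X, ‖f.ker a b‖) (⨆ a : G × X, ∑ᶠ b : G × X, ‖f.ker b a‖)

end ConvAlgebra

variable [DiscreteTopology G] [T2Space X]

/-- The `*`-representations of `C_c(R)` that are bounded by the `I`-norm. -/
def boundedReps : Set (HilbertRep θ.ConvAlgebra) :=
  {π | ∀ f : θ.ConvAlgebra, ‖π.toHom f‖ ≤ f.iNorm}

instance : PointwiseBounded θ.boundedReps where
  bdd f := ⟨f.iNorm, by rintro _ ⟨π, rfl⟩; exact π.2 f⟩

/-- The full groupoid C*-algebra `C*(R)`. -/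
abbrev GroupoidCStar : Type (max u v) := RepCStar θ.boundedReps

/-! ### The Fell bundle and its envelope C*-algebra -/

end TopologicalPartialAction

namespace TopologicalPartialAction

variable {G : Type u} {X : Type v} [Group G] [TopologicalSpace X]
variable (θ : TopologicalPartialAction G X)

/-- `C₀(X_t)`, as the ideal of all `f ∈ C₀(X)` that vanish off `X_t`. It is the fibre
`B_t = C₀(X_t) δ_t` of the Fell bundle, whose operations are `fellMul` and `fellStar`. -/
noncomputable def fiber (t : G) : Submodule ℂ C₀(X, ℂ) where
  carrier := {f | ∀ x, x ∉ θ.dom t → f x = 0}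
  add_mem' hf hg x hx := by simp [hf x hx, hg x hx]
  zero_mem' _ _ := rfl
  smul_mem' c f hf x hx := by simp [hf x hx]

theorem fiber_apply {t : G} (f : θ.fiber t) {x : X} (hx : x ∉ θ.dom t) : f.1 x = 0 := f.2 x hx

open Classical in
/-- `f ∘ h_t⁻¹` on `X_t`, extended by zero. -/
noncomputable def pushforward (t : G) (f : C₀(X, ℂ)) (x : X) : ℂ :=
  if x ∈ θ.dom t then f ((θ.h t).symm x) else 0

theorem pushforward_of_mem {t : G} (f : C₀(X, ℂ)) {x : X} (hx : x ∈ θ.dom t) :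
    θ.pushforward t f x = f (θ.h t⁻¹ x) := by
  rw [pushforward, if_pos hx, θ.symm_eq hx]

theorem pushforward_of_notMem {t : G} (f : C₀(X, ℂ)) {x : X} (hx : x ∉ θ.dom t) :
    θ.pushforward t f x = 0 := if_neg hx

theorem isCompact_pushforward {t : G} (f : θ.fiber t⁻¹) {ε : ℝ} (hε : 0 < ε) :
    IsCompact {x | ε ≤ ‖θ.pushforward t f.1 x‖} := by
  have h1 : IsCompact {x | ε ≤ ‖f.1 x‖} := by
    have hz := (zero_at_infty f.1).norm
    rw [norm_zero] at hz
    obtain ⟨K, hK, hKs⟩ := Filter.mem_cocompact.1 (hz (Iio_mem_nhds hε))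
    refine hK.of_isClosed_subset (isClosed_le continuous_const f.1.continuous.norm) fun x hx => ?_
    by_contra hxK
    have h2 : ‖f.1 x‖ < ε := hKs hxK
    exact not_le.2 h2 hx
  have hsub : {x | ε ≤ ‖f.1 x‖} ⊆ (θ.h t).source := fun x hx => by
    rw [θ.source_h]
    by_contra h
    rw [Set.mem_ofPred_eq, θ.fiber_apply f h, norm_zero] at hx
    exact absurd hx (not_le.2 hε)
  have h2 := h1.image_of_continuousOn ((θ.h t).continuousOn.mono hsub)
  convert h2 using 1
  ext x
  constructor
  · intro hx
    have hxt : x ∈ θ.dom t := by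
      by_contra h
      rw [Set.mem_ofPred_eq, θ.pushforward_of_notMem _ h, norm_zero] at hx
      exact absurd hx (not_le.2 hε)
    rw [Set.mem_ofPred_eq, pushforward, if_pos hxt] at hx
    exact ⟨_, hx, (θ.h t).right_inv (by rwa [θ.target_h])⟩
  · rintro ⟨y, hy, rfl⟩
    have hys := hsub hy
    rw [Set.mem_ofPred_eq, pushforward, if_pos, (θ.h t).left_inv hys]
    · exact hy
    · exact θ.h_mem (by rwa [← θ.source_h])

variable [T2Space X]

theorem continuous_pushforward {t : G} (f : θ.fiber t⁻¹) :
    Continuous (θ.pushforward t f.1) := by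
  refine continuous_iff_continuousAt.2 fun x => ?_
  by_cases hx : x ∈ θ.dom t
  · have hxt : x ∈ (θ.h t).target := by rwa [θ.target_h]
    have h1 : ContinuousAt (fun y => f.1 ((θ.h t).symm y)) x :=
      f.1.continuous.continuousAt.comp ((θ.h t).symm.continuousAt hxt)
    refine h1.congr ?_
    filter_upwards [(θ.isOpen_dom t).mem_nhds hx] with y hy
    rw [pushforward, if_pos hy]
  · rw [ContinuousAt, θ.pushforward_of_notMem _ hx, Metric.tendsto_nhds]
    intro ε hε
    have h1 := (θ.isCompact_pushforward f hε).isClosed.isOpen_compl.mem_nhds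
      (x := x) (by simpa [θ.pushforward_of_notMem _ hx] using hε)
    filter_upwards [h1] with y hy
    simpa using hy

/-- The partial action `α_t : C₀(X_{t⁻¹}) → C₀(X_t)`, `α_t f = f ∘ h_t⁻¹`. -/
noncomputable def alpha (t : G) (f : θ.fiber t⁻¹) : θ.fiber t where
  val :=
    { toFun := θ.pushforward t f.1
      continuous_toFun := θ.continuous_pushforward f
      zero_at_infty' := by
        refine Metric.tendsto_nhds.2 fun ε hε => ?_
        filter_upwards [(θ.isCompact_pushforward f hε).compl_mem_cocompact] with y hy
        simpa using hy }
  property _ hx := θ.pushforward_of_notMem _ hx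

theorem alpha_apply (t : G) (f : θ.fiber t⁻¹) {x : X} (hx : x ∈ θ.dom t) :
    (θ.alpha t f).1 x = f.1 (θ.h t⁻¹ x) := θ.pushforward_of_mem f.1 hx

/-- The product `(a δ_r) (b δ_s) = α_r (α_{r⁻¹}(a) b) δ_{rs}` of the Fell bundle. -/
noncomputable def fellMul {r s : G} (a : θ.fiber r) (b : θ.fiber s) : θ.fiber (r * s) where
  val := (θ.alpha r ⟨(θ.alpha r⁻¹ ⟨a.1, by simp⟩).1 * b.1, fun x hx => by
    rw [ZeroAtInftyContinuousMap.mul_apply, θ.fiber_apply _ hx, zero_mul]⟩).1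
  property x hx := by
    by_cases hxr : x ∈ θ.dom r
    · rw [θ.alpha_apply _ _ hxr]
      change _ * b.1 (θ.h r⁻¹ x) = 0
      rw [θ.fiber_apply b, mul_zero]
      intro hs
      refine hx ?_
      have hm : θ.h r⁻¹ x ∈ θ.dom r⁻¹ := θ.h_mem (by simpa using hxr)
      have := θ.h_mem_mul hm hs
      have h2 := θ.h_inv_h (t := r⁻¹) (x := x) (by rwa [inv_inv])
      rw [inv_inv] at h2
      rwa [h2] at this
    · exact θ.fiber_apply _ hxr

theorem fellMul_apply {r s : G} (a : θ.fiber r) (b : θ.fiber s) (x : X) :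
    (θ.fellMul a b).1 x = a.1 x * b.1 (θ.h r⁻¹ x) := by
  by_cases hxr : x ∈ θ.dom r
  · have hm : θ.h r⁻¹ x ∈ θ.dom r⁻¹ := θ.h_mem (by simpa using hxr)
    have h2 := θ.h_inv_h (t := r⁻¹) (x := x) (by simpa using hxr)
    rw [fellMul, θ.alpha_apply _ _ hxr]
    change (θ.alpha r⁻¹ _).1 _ * _ = _
    rw [θ.alpha_apply _ _ hm]
    exact congrArg (fun y => a.1 y * b.1 (θ.h r⁻¹ x)) h2
  · rw [θ.fiber_apply a hxr, zero_mul]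
    exact θ.pushforward_of_notMem _ hxr

/-- The involution `(a δ_t)* = α_{t⁻¹}(a*) δ_{t⁻¹}` of the Fell bundle. -/
noncomputable def fellStar {t : G} (a : θ.fiber t) : θ.fiber t⁻¹ :=
  θ.alpha t⁻¹ ⟨star a.1, fun x hx => by
    rw [ZeroAtInftyContinuousMap.star_apply, θ.fiber_apply a (by simpa using hx), star_zero]⟩

theorem fellStar_apply {t : G} (a : θ.fiber t) {x : X} (hx : x ∈ θ.dom t⁻¹) :
    (θ.fellStar a).1 x = star (a.1 (θ.h t x)) := by
  rw [fellStar, θ.alpha_apply _ _ hx]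
  change star (a.1 (θ.h t⁻¹⁻¹ x)) = _
  rw [inv_inv]

theorem norm_fellMul_le {r s : G} (a : θ.fiber r) (b : θ.fiber s) :
    ‖(θ.fellMul a b).1‖ ≤ ‖a.1‖ * ‖b.1‖ := by
  rw [← ZeroAtInftyContinuousMap.norm_toBCF_eq_norm]
  refine (BoundedContinuousFunction.norm_le (mul_nonneg (norm_nonneg _) (norm_nonneg _))).2
    fun x => ?_
  change ‖(θ.fellMul a b).1 x‖ ≤ _
  rw [fellMul_apply, norm_mul]
  exact mul_le_mul (a.1.toBCF.norm_coe_le_norm x) (b.1.toBCF.norm_coe_le_norm _)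
    (norm_nonneg _) (norm_nonneg _)

theorem norm_fellStar_le {t : G} (a : θ.fiber t) : ‖(θ.fellStar a).1‖ ≤ ‖a.1‖ := by
  rw [← ZeroAtInftyContinuousMap.norm_toBCF_eq_norm]
  refine (BoundedContinuousFunction.norm_le (norm_nonneg _)).2 fun x => ?_
  change ‖(θ.fellStar a).1 x‖ ≤ _
  by_cases hx : x ∈ θ.dom t⁻¹
  · rw [θ.fellStar_apply a hx, norm_star]
    exact a.1.toBCF.norm_coe_le_norm _
  · rw [θ.fiber_apply _ hx, norm_zero]
    exact norm_nonneg _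

/-- The `*`-algebra `k_c(B)`: finitely supported `k : G × G → B` with `k(r, s) ∈ B_{r s⁻¹}`. -/
structure KernelAlgebra where
  /-- the values of the kernel -/
  toFinsupp : G × G →₀ C₀(X, ℂ)
  mem_fiber : ∀ r s, toFinsupp (r, s) ∈ θ.fiber (r * s⁻¹)

namespace KernelAlgebra

variable {θ}

/-- `k(r, s) ∈ B_{r s⁻¹}`. -/
noncomputable def val (k : θ.KernelAlgebra) (r s : G) : θ.fiber (r * s⁻¹) :=
  ⟨k.toFinsupp (r, s), k.mem_fiber r s⟩

theorem ext_val {k l : θ.KernelAlgebra} (h : ∀ r s x, (k.val r s).1 x = (l.val r s).1 x) :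
    k = l := by
  obtain ⟨k, hk⟩ := k
  obtain ⟨l, hl⟩ := l
  have : k = l := Finsupp.ext fun p => ZeroAtInftyContinuousMap.ext fun x => h p.1 p.2 x
  subst this
  rfl

noncomputable instance : Zero θ.KernelAlgebra where
  zero := ⟨0, fun _ _ => (θ.fiber _).zero_mem⟩

noncomputable instance : Add θ.KernelAlgebra where
  add k l := ⟨k.1 + l.1, fun r s => (θ.fiber _).add_mem (k.2 r s) (l.2 r s)⟩

noncomputable instance : Neg θ.KernelAlgebra where
  neg k := ⟨-k.1, fun r s => (θ.fiber _).neg_mem (k.2 r s)⟩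

noncomputable instance : SMul ℂ θ.KernelAlgebra where
  smul c k := ⟨c • k.1, fun r s => (θ.fiber _).smul_mem c (k.2 r s)⟩

theorem val_zero (r s : G) : (0 : θ.KernelAlgebra).val r s = 0 := rfl

theorem val_add (k l : θ.KernelAlgebra) (r s : G) : (k + l).val r s = k.val r s + l.val r s := rfl

theorem val_neg (k : θ.KernelAlgebra) (r s : G) : (-k).val r s = -k.val r s := rfl

theorem val_smul (c : ℂ) (k : θ.KernelAlgebra) (r s : G) : (c • k).val r s = c • k.val r s := rfl

noncomputable instance : AddCommGroup θ.KernelAlgebra where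
  add_assoc k l m := ext_val fun r s x => by simp [val_add, add_assoc]
  zero_add k := ext_val fun r s x => by simp [val_add, val_zero]
  add_zero k := ext_val fun r s x => by simp [val_add, val_zero]
  neg_add_cancel k := ext_val fun r s x => by simp [val_add, val_neg, val_zero]
  add_comm k l := ext_val fun r s x => by simp [val_add, add_comm]
  nsmul := nsmulRec
  zsmul := zsmulRec

noncomputable instance : Module ℂ θ.KernelAlgebra where
  one_smul k := ext_val fun r s x => by simp [val_smul]
  mul_smul c d k := ext_val fun r s x => by simp [val_smul, mul_assoc]
  smul_zero c := ext_val fun r s x => by simp [val_smul, val_zero]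
  smul_add c k l := ext_val fun r s x => by simp [val_smul, val_add]
  add_smul c d k := ext_val fun r s x => by simp [val_smul, val_add, add_mul]
  zero_smul k := ext_val fun r s x => by simp [val_smul, val_zero]

/-- A finite set `F` with `k` supported in `F × F`. -/
theorem exists_finset (k : θ.KernelAlgebra) :
    ∃ F : Finset G, ∀ r s, k.val r s ≠ 0 → r ∈ F ∧ s ∈ F := by
  classical
  refine ⟨k.toFinsupp.support.image Prod.fst ∪ k.toFinsupp.support.image Prod.snd,
    fun r s h => ?_⟩
  have hm : (r, s) ∈ k.toFinsupp.support := by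
    rw [Finsupp.mem_support_iff]
    exact fun h0 => h (Subtype.ext h0)
  exact ⟨Finset.mem_union_left _ (Finset.mem_image_of_mem _ hm),
    Finset.mem_union_right _ (Finset.mem_image_of_mem _ hm)⟩

theorem exists_finset₂ (k l : θ.KernelAlgebra) : ∃ F : Finset G,
    (∀ r s, k.val r s ≠ 0 → r ∈ F ∧ s ∈ F) ∧ (∀ r s, l.val r s ≠ 0 → r ∈ F ∧ s ∈ F) := by
  classical
  obtain ⟨F, hF⟩ := k.exists_finset
  obtain ⟨F', hF'⟩ := l.exists_finset
  exact ⟨F ∪ F', fun r s h => ⟨Finset.mem_union_left _ (hF r s h).1,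
    Finset.mem_union_left _ (hF r s h).2⟩, fun r s h => ⟨Finset.mem_union_right _ (hF' r s h).1,
    Finset.mem_union_right _ (hF' r s h).2⟩⟩

theorem fellMul_mem (k l : θ.KernelAlgebra) (r s t : G) :
    (θ.fellMul (k.val r t) (l.val t s)).1 ∈ θ.fiber (r * s⁻¹) := by
  have := (θ.fellMul (k.val r t) (l.val t s)).2
  simpa [mul_assoc] using this

theorem fellMul_eq_zero (k l : θ.KernelAlgebra) {r s t : G}
    (h : k.val r t = 0 ∨ l.val t s = 0) : (θ.fellMul (k.val r t) (l.val t s)).1 = 0 := by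
  ext x
  rw [fellMul_apply]
  rcases h with h | h <;> simp [h]

/-- `(k * l)(r, s) = ∑_t k(r, t) l(t, s)`. -/
noncomputable def mulFun (k l : θ.KernelAlgebra) (p : G × G) : C₀(X, ℂ) :=
  ∑ᶠ t : G, (θ.fellMul (k.val p.1 t) (l.val t p.2)).1

theorem mulFun_eq_sum (k l : θ.KernelAlgebra) {F : Finset G}
    (hF : ∀ r s, k.val r s ≠ 0 → r ∈ F ∧ s ∈ F) (p : G × G) :
    mulFun k l p = ∑ t ∈ F, (θ.fellMul (k.val p.1 t) (l.val t p.2)).1 := by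
  refine finsum_eq_sum_of_support_subset _ fun t ht => ?_
  by_contra h
  exact ht (fellMul_eq_zero k l (Or.inl (not_not.1 fun h' => h (hF _ _ h').2)))

noncomputable instance : Mul θ.KernelAlgebra where
  mul k l :=
    { toFinsupp := Finsupp.ofSupportFinite (mulFun k l) (by
        obtain ⟨F, hF, hF'⟩ := exists_finset₂ k l
        refine (F ×ˢ F).finite_toSet.subset fun p hp => ?_
        by_contra h
        refine hp ?_
        rw [mulFun_eq_sum k l hF]
        refine Finset.sum_eq_zero fun t _ => fellMul_eq_zero k l ?_
        by_contra h'
        rw [not_or] at h'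
        exact h (Finset.mem_coe.2 (Finset.mem_product.2 ⟨(hF _ _ h'.1).1, (hF' _ _ h'.2).2⟩)))
      mem_fiber := fun r s => by
        obtain ⟨F, hF⟩ := k.exists_finset
        rw [Finsupp.ofSupportFinite_coe, mulFun_eq_sum k l hF]
        exact Submodule.sum_mem _ fun t _ => fellMul_mem k l r s t }

theorem val_mul (k l : θ.KernelAlgebra) {F : Finset G}
    (hF : ∀ r s, k.val r s ≠ 0 → r ∈ F ∧ s ∈ F) (r s : G) :
    ((k * l).val r s).1 = ∑ t ∈ F, (θ.fellMul (k.val r t) (l.val t s)).1 :=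
  mulFun_eq_sum k l hF (r, s)

theorem sum_apply {ι : Type*} (F : Finset ι) (f : ι → C₀(X, ℂ)) (x : X) :
    (∑ t ∈ F, f t) x = ∑ t ∈ F, f t x := by
  classical
  induction F using Finset.induction_on with
  | empty => simp
  | insert a F ha ih => simp [Finset.sum_insert ha, ih]

theorem val_mul_apply (k l : θ.KernelAlgebra) {F : Finset G}
    (hF : ∀ r s, k.val r s ≠ 0 → r ∈ F ∧ s ∈ F) (r s : G) (x : X) :
    ((k * l).val r s).1 x =
      ∑ t ∈ F, (k.val r t).1 x * (l.val t s).1 (θ.h (r * t⁻¹)⁻¹ x) := by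
  rw [val_mul k l hF, sum_apply]
  simp only [fellMul_apply]

theorem support_mul (k l : θ.KernelAlgebra) {F : Finset G}
    (hF : ∀ r s, k.val r s ≠ 0 → r ∈ F ∧ s ∈ F)
    (hF' : ∀ r s, l.val r s ≠ 0 → r ∈ F ∧ s ∈ F) (r s : G) (h : (k * l).val r s ≠ 0) :
    r ∈ F ∧ s ∈ F := by
  by_contra h'
  refine h (Subtype.ext ?_)
  rw [val_mul k l hF]
  refine Finset.sum_eq_zero fun t _ => fellMul_eq_zero k l ?_
  by_contra h2
  rw [not_or] at h2
  exact h' ⟨(hF _ _ h2.1).1, (hF' _ _ h2.2).2⟩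

theorem mono_support {k : θ.KernelAlgebra} {F F' : Finset G} (h : F ⊆ F')
    (hF : ∀ r s, k.val r s ≠ 0 → r ∈ F ∧ s ∈ F) :
    ∀ r s, k.val r s ≠ 0 → r ∈ F' ∧ s ∈ F' :=
  fun r s hk => ⟨h (hF r s hk).1, h (hF r s hk).2⟩

theorem exists_finset₃ (k l m : θ.KernelAlgebra) : ∃ F : Finset G,
    (∀ r s, k.val r s ≠ 0 → r ∈ F ∧ s ∈ F) ∧ (∀ r s, l.val r s ≠ 0 → r ∈ F ∧ s ∈ F) ∧
    (∀ r s, m.val r s ≠ 0 → r ∈ F ∧ s ∈ F) := by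
  classical
  obtain ⟨F, hF, hF'⟩ := exists_finset₂ k l
  obtain ⟨E, hE⟩ := m.exists_finset
  exact ⟨F ∪ E, mono_support Finset.subset_union_left hF, mono_support Finset.subset_union_left hF',
    mono_support Finset.subset_union_right hE⟩

theorem support_add (k l : θ.KernelAlgebra) {F : Finset G}
    (hF : ∀ r s, k.val r s ≠ 0 → r ∈ F ∧ s ∈ F)
    (hF' : ∀ r s, l.val r s ≠ 0 → r ∈ F ∧ s ∈ F) (r s : G) (h : (k + l).val r s ≠ 0) :
    r ∈ F ∧ s ∈ F := by
  by_contra h'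
  refine h ?_
  rw [val_add, not_not.1 fun h2 => h' (hF r s h2), not_not.1 fun h2 => h' (hF' r s h2), add_zero]

noncomputable instance : NonUnitalRing θ.KernelAlgebra where
  left_distrib k l m := ext_val fun r s x => by
    obtain ⟨F, hF⟩ := k.exists_finset
    simp only [val_mul_apply _ _ hF, val_add, Submodule.coe_add,
      ZeroAtInftyContinuousMap.add_apply, mul_add, Finset.sum_add_distrib]
  right_distrib k l m := ext_val fun r s x => by
    obtain ⟨F, hF, hF'⟩ := exists_finset₂ k l
    rw [val_mul_apply _ _ (support_add k l hF hF'), val_add, Submodule.coe_add,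
      ZeroAtInftyContinuousMap.add_apply, val_mul_apply _ _ hF, val_mul_apply _ _ hF',
      ← Finset.sum_add_distrib]
    simp only [val_add, Submodule.coe_add, ZeroAtInftyContinuousMap.add_apply, add_mul]
  zero_mul k := ext_val fun r s x => by
    rw [val_mul_apply (F := ∅) _ _ (fun r s h => absurd (val_zero r s) h)]
    simp [val_zero]
  mul_zero k := ext_val fun r s x => by
    obtain ⟨F, hF⟩ := k.exists_finset
    simp [val_mul_apply _ _ hF, val_zero]
  mul_assoc k l m := ext_val fun r s x => by
    obtain ⟨F, hF, hF'⟩ := exists_finset₂ k l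
    rw [val_mul_apply _ _ (support_mul k l hF hF'), val_mul_apply _ _ hF]
    simp only [val_mul_apply _ _ hF, val_mul_apply _ _ hF', Finset.sum_mul, Finset.mul_sum]
    rw [Finset.sum_comm]
    refine Finset.sum_congr rfl fun t _ => Finset.sum_congr rfl fun u _ => ?_
    by_cases hx : x ∈ θ.dom (r * t⁻¹)
    · by_cases hy : θ.h (r * t⁻¹)⁻¹ x ∈ θ.dom (t * u⁻¹)
      · have hxu : x ∈ θ.dom (r * u⁻¹) := by
          have hm : θ.h (r * t⁻¹)⁻¹ x ∈ θ.dom (r * t⁻¹)⁻¹ := θ.h_mem (by simpa using hx)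
          have h1 := θ.h_mem_mul hm hy
          have h2 := θ.h_inv_h (t := (r * t⁻¹)⁻¹) (x := x) (by simpa using hx)
          rw [inv_inv] at h2
          rw [h2] at h1
          simpa [mul_assoc] using h1
        have h3 := θ.h_h (t * u⁻¹)⁻¹ (r * t⁻¹)⁻¹ x
          ⟨by simpa using hx, by simpa [mul_assoc] using hxu⟩
        rw [h3, mul_assoc]
        simp [mul_assoc]
      · rw [θ.fiber_apply (l.val t u) hy]
        simp
    · rw [θ.fiber_apply (k.val r t) hx]
      simp

instance : IsScalarTower ℂ θ.KernelAlgebra θ.KernelAlgebra where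
  smul_assoc c k l := ext_val fun r s x => by
    obtain ⟨F, hF⟩ := k.exists_finset
    have hF' : ∀ r s, (c • k).val r s ≠ 0 → r ∈ F ∧ s ∈ F := fun r s h => hF r s fun h0 => h <| by
      rw [val_smul, h0, smul_zero]
    simp only [smul_eq_mul, val_smul, Submodule.coe_smul, ZeroAtInftyContinuousMap.smul_apply,
      val_mul_apply _ _ hF, val_mul_apply _ _ hF', Finset.mul_sum, mul_assoc]

instance : SMulCommClass ℂ θ.KernelAlgebra θ.KernelAlgebra where
  smul_comm c k l := ext_val fun r s x => by
    obtain ⟨F, hF⟩ := k.exists_finset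
    simp only [smul_eq_mul, val_smul, Submodule.coe_smul, ZeroAtInftyContinuousMap.smul_apply,
      val_mul_apply _ _ hF, Finset.mul_sum, mul_left_comm]

/-- The involution `k*(r, s) = k(s, r)*`. -/
noncomputable instance : Star θ.KernelAlgebra where
  star k :=
    { toFinsupp := Finsupp.ofSupportFinite (fun p => (θ.fellStar (k.val p.2 p.1)).1) (by
        obtain ⟨F, hF⟩ := k.exists_finset
        refine (F ×ˢ F).finite_toSet.subset fun p hp => ?_
        rw [Finset.mem_coe, Finset.mem_product]
        refine (hF p.2 p.1 fun h0 => hp ?_).symm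
        have := θ.norm_fellStar_le (k.val p.2 p.1)
        rw [h0] at this
        dsimp only
        rw [h0]
        simpa using this)
      mem_fiber := fun r s => by
        have h1 := (θ.fellStar (k.val s r)).2
        rw [Finsupp.ofSupportFinite_coe]
        simpa using h1 }

theorem val_star (k : θ.KernelAlgebra) (r s : G) :
    ((star k).val r s).1 = (θ.fellStar (k.val s r)).1 := rfl

theorem val_star_apply (k : θ.KernelAlgebra) (r s : G) {x : X} (hx : x ∈ θ.dom (r * s⁻¹)) :
    ((star k).val r s).1 x = star ((k.val s r).1 (θ.h (s * r⁻¹) x)) := by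
  rw [val_star, θ.fellStar_apply]
  simpa using hx

theorem support_star (k : θ.KernelAlgebra) {F : Finset G}
    (hF : ∀ r s, k.val r s ≠ 0 → r ∈ F ∧ s ∈ F) (r s : G) (h : (star k).val r s ≠ 0) :
    r ∈ F ∧ s ∈ F := by
  refine (hF s r fun h0 => h (Subtype.ext ?_)).symm
  have := θ.norm_fellStar_le (k.val s r)
  rw [val_star]
  rw [h0] at this ⊢
  simpa using this

/-- To compare two kernels it is enough to evaluate them on the domains. -/
theorem ext_dom {k l : θ.KernelAlgebra}
    (h : ∀ r s, ∀ x ∈ θ.dom (r * s⁻¹), (k.val r s).1 x = (l.val r s).1 x) : k = l :=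
  ext_val fun r s x => by
    by_cases hx : x ∈ θ.dom (r * s⁻¹)
    · exact h r s x hx
    · rw [θ.fiber_apply _ hx, θ.fiber_apply _ hx]

theorem dom_swap {r s : G} {x : X} (hx : x ∈ θ.dom (r * s⁻¹)) :
    θ.h (s * r⁻¹) x ∈ θ.dom (s * r⁻¹) := θ.h_mem (by simpa using hx)

theorem h_swap {r s : G} {x : X} (hx : x ∈ θ.dom (r * s⁻¹)) :
    θ.h (r * s⁻¹) (θ.h (s * r⁻¹) x) = x := by
  have := θ.h_inv_h (t := s * r⁻¹) (x := x) (by simpa using hx)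
  simpa using this

noncomputable instance : StarRing θ.KernelAlgebra where
  star_involutive k := ext_dom fun r s x hx => by
    rw [val_star_apply _ _ _ hx, val_star_apply _ _ _ (dom_swap hx), h_swap hx, star_star]
  star_mul k l := ext_dom fun r s x hx => by
    obtain ⟨F, hF, hF'⟩ := exists_finset₂ k l
    rw [val_star_apply _ _ _ hx, val_mul_apply _ _ hF, val_mul_apply _ _ (support_star l hF'),
      star_sum]
    refine Finset.sum_congr rfl fun t _ => ?_
    rw [star_mul]
    by_cases hxt : x ∈ θ.dom (r * t⁻¹)
    · have hst : θ.h (t * r⁻¹) x ∈ θ.dom (t * s⁻¹) := by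
        have := θ.h_mem_mul (t := t * r⁻¹) (x := x) (by simpa using hxt) hx
        simpa [mul_assoc] using this
      have hyt : θ.h (s * r⁻¹) x ∈ θ.dom (s * t⁻¹) := by
        have := θ.h_mem_mul (t := s * r⁻¹) (x := x) (by simpa using hx) hxt
        simpa [mul_assoc] using this
      have e1 : θ.h (s * t⁻¹)⁻¹ (θ.h (s * r⁻¹) x) = θ.h (t * r⁻¹) x := by
        rw [θ.h_h (s * t⁻¹)⁻¹ (s * r⁻¹) x ⟨by simpa using hx, by simpa [mul_assoc] using hxt⟩]
        simp [mul_assoc]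
      have e2 : θ.h (s * t⁻¹) (θ.h (t * r⁻¹) x) = θ.h (s * r⁻¹) x := by
        rw [θ.h_h (s * t⁻¹) (t * r⁻¹) x ⟨by simpa using hxt, by simpa [mul_assoc] using hx⟩]
        simp [mul_assoc]
      have e3 : (r * t⁻¹)⁻¹ = t * r⁻¹ := by simp
      have e4 : t * s⁻¹ = (s * t⁻¹)⁻¹ := by simp
      rw [val_star_apply _ _ _ hxt, e3, val_star_apply _ _ _ hst, e2, ← e1, ← e4]
    · rw [θ.fiber_apply ((star l).val r t) hxt, zero_mul]
      have : (k.val s t).1 (θ.h (s * r⁻¹) x) = 0 := by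
        refine θ.fiber_apply _ fun hy => hxt ?_
        have := θ.h_mem_mul (t := r * s⁻¹) (x := θ.h (s * r⁻¹) x)
          (by simpa using dom_swap hx) hy
        rw [h_swap hx] at this
        simpa [mul_assoc] using this
      rw [this, star_zero, mul_zero]
  star_add k l := ext_dom fun r s x hx => by
    rw [val_star_apply _ _ _ hx]
    simp only [val_add, Submodule.coe_add, ZeroAtInftyContinuousMap.add_apply,
      val_star_apply _ _ _ hx, star_add]

instance : StarModule ℂ θ.KernelAlgebra where
  star_smul c k := ext_dom fun r s x hx => by
    rw [val_star_apply _ _ _ hx]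
    simp only [val_smul, Submodule.coe_smul, ZeroAtInftyContinuousMap.smul_apply, smul_eq_mul,
      val_star_apply _ _ _ hx, star_mul']

/-- `‖k‖ = (∑_{r, s} ‖k(r, s)‖²)^{1/2}`. -/
noncomputable instance : Norm θ.KernelAlgebra where
  norm k := √(∑ᶠ p : G × G, ‖(k.val p.1 p.2).1‖ ^ 2)

theorem norm_eq (k : θ.KernelAlgebra) {F : Finset G}
    (hF : ∀ r s, k.val r s ≠ 0 → r ∈ F ∧ s ∈ F) :
    ‖k‖ = √(∑ r ∈ F, ∑ s ∈ F, ‖(k.val r s).1‖ ^ 2) := by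
  change √_ = _
  rw [← Finset.sum_product' F F (fun r s => ‖(k.val r s).1‖ ^ 2),
    finsum_eq_sum_of_support_subset]
  intro p hp
  rw [Finset.mem_coe, Finset.mem_product]
  refine hF p.1 p.2 fun h0 => hp ?_
  dsimp only
  rw [h0]
  simp

theorem norm_nonneg' (k : θ.KernelAlgebra) : 0 ≤ ‖k‖ := Real.sqrt_nonneg _

theorem norm_sq (k : θ.KernelAlgebra) {F : Finset G}
    (hF : ∀ r s, k.val r s ≠ 0 → r ∈ F ∧ s ∈ F) :
    ‖k‖ ^ 2 = ∑ r ∈ F, ∑ s ∈ F, ‖(k.val r s).1‖ ^ 2 := by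
  rw [norm_eq k hF, Real.sq_sqrt]
  exact Finset.sum_nonneg fun r _ => Finset.sum_nonneg fun s _ => sq_nonneg _

theorem norm_add_le' (k l : θ.KernelAlgebra) : ‖k + l‖ ≤ ‖k‖ + ‖l‖ := by
  obtain ⟨F, hF, hF'⟩ := exists_finset₂ k l
  let e : (θ.KernelAlgebra) → EuclideanSpace ℝ (F ×ˢ F : Finset (G × G)) :=
    fun k => WithLp.toLp 2 fun p => ‖(k.val p.1.1 p.1.2).1‖
  have he : ∀ k : θ.KernelAlgebra, (∀ r s, k.val r s ≠ 0 → r ∈ F ∧ s ∈ F) → ‖k‖ = ‖e k‖ := by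
    intro k hk
    rw [norm_eq k hk, EuclideanSpace.norm_eq, ← Finset.sum_product' F F
      (fun r s => ‖(k.val r s).1‖ ^ 2), ← Finset.sum_coe_sort (F ×ˢ F)]
    simp [e]
  rw [he k hF, he l hF']
  refine le_trans ?_ (norm_add_le _ _)
  rw [norm_eq _ (support_add k l hF hF'), EuclideanSpace.norm_eq]
  refine Real.sqrt_le_sqrt ?_
  rw [← Finset.sum_product' F F (fun r s => ‖((k + l).val r s).1‖ ^ 2),
    ← Finset.sum_coe_sort (F ×ˢ F)]
  refine Finset.sum_le_sum fun p _ => ?_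
  have h1 : ‖((k + l).val p.1.1 p.1.2).1‖ ≤
      ‖(k.val p.1.1 p.1.2).1‖ + ‖(l.val p.1.1 p.1.2).1‖ := by
    rw [val_add, Submodule.coe_add]
    exact norm_add_le _ _
  have h2 : ‖(e k + e l) p‖ = ‖(k.val p.1.1 p.1.2).1‖ + ‖(l.val p.1.1 p.1.2).1‖ := by
    rw [PiLp.add_apply, Real.norm_of_nonneg (add_nonneg (norm_nonneg _) (norm_nonneg _))]
  rw [h2]
  exact pow_le_pow_left₀ (norm_nonneg _) h1 2

theorem norm_smul_eq (c : ℂ) (k : θ.KernelAlgebra) : ‖c • k‖ = ‖c‖ * ‖k‖ := by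
  obtain ⟨F, hF⟩ := k.exists_finset
  have hF' : ∀ r s, (c • k).val r s ≠ 0 → r ∈ F ∧ s ∈ F := fun r s h => hF r s fun h0 => h <| by
    rw [val_smul, h0, smul_zero]
  rw [norm_eq _ hF', norm_eq _ hF]
  simp only [val_smul, Submodule.coe_smul, norm_smul, mul_pow, ← Finset.mul_sum]
  rw [Real.sqrt_mul (sq_nonneg _), Real.sqrt_sq (norm_nonneg _)]

theorem eq_zero_of_norm (k : θ.KernelAlgebra) (h : ‖k‖ = 0) : k = 0 := by
  obtain ⟨F, hF⟩ := k.exists_finset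
  have h1 := norm_sq k hF
  rw [h, zero_pow two_ne_zero, eq_comm,
    Finset.sum_eq_zero_iff_of_nonneg fun r _ => Finset.sum_nonneg fun s _ => sq_nonneg _] at h1
  refine ext_val fun r s x => ?_
  suffices k.val r s = 0 by rw [this, val_zero]
  by_contra h0
  have h2 := h1 r (hF r s h0).1
  rw [Finset.sum_eq_zero_iff_of_nonneg fun s _ => sq_nonneg _] at h2
  have h3 := h2 s (hF r s h0).2
  rw [pow_eq_zero_iff two_ne_zero, norm_eq_zero] at h3
  exact h0 (Subtype.ext h3)

noncomputable instance : NormedAddCommGroup θ.KernelAlgebra :=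
  AddGroupNorm.toNormedAddCommGroup
    { toFun := fun k : θ.KernelAlgebra => ‖k‖
      map_zero' := by
        have := norm_smul_eq (0 : ℂ) (0 : θ.KernelAlgebra)
        simpa using this
      add_le' := norm_add_le'
      neg' := fun k => by
        have := norm_smul_eq (-1 : ℂ) k
        simpa using this
      eq_zero_of_map_eq_zero' := eq_zero_of_norm }

theorem norm_mul_le' (k l : θ.KernelAlgebra) : ‖k * l‖ ≤ ‖k‖ * ‖l‖ := by
  obtain ⟨F, hF, hF'⟩ := exists_finset₂ k l
  refine le_of_sq_le_sq ?_ (mul_nonneg (norm_nonneg' _) (norm_nonneg' _))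
  rw [mul_pow, norm_sq _ (support_mul k l hF hF'), norm_sq k hF, norm_sq l hF']
  have h1 : ∀ r s, ‖((k * l).val r s).1‖ ^ 2 ≤
      (∑ t ∈ F, ‖(k.val r t).1‖ ^ 2) * ∑ t ∈ F, ‖(l.val t s).1‖ ^ 2 := by
    intro r s
    refine le_trans ?_ (Finset.sum_mul_sq_le_sq_mul_sq F _ _)
    refine pow_le_pow_left₀ (norm_nonneg _) ?_ 2
    rw [val_mul k l hF]
    exact (norm_sum_le _ _).trans (Finset.sum_le_sum fun t _ => θ.norm_fellMul_le _ _)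
  refine (Finset.sum_le_sum fun r _ => Finset.sum_le_sum fun s _ => h1 r s).trans (le_of_eq ?_)
  simp only [← Finset.mul_sum, ← Finset.sum_mul]
  rw [Finset.sum_comm (f := fun s t => ‖(l.val t s).1‖ ^ 2)]

noncomputable instance : NonUnitalNormedRing θ.KernelAlgebra where
  __ : NormedAddCommGroup θ.KernelAlgebra := inferInstance
  __ : NonUnitalRing θ.KernelAlgebra := inferInstance
  norm_mul_le := norm_mul_le'

noncomputable instance : NormedSpace ℂ θ.KernelAlgebra where
  norm_smul_le c k := (norm_smul_eq c k).le

instance : NormedStarGroup θ.KernelAlgebra where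
  norm_star_le k := by
    obtain ⟨F, hF⟩ := k.exists_finset
    refine le_of_sq_le_sq ?_ (norm_nonneg' _)
    rw [norm_sq _ (support_star k hF), norm_sq _ hF, Finset.sum_comm]
    exact Finset.sum_le_sum fun r _ => Finset.sum_le_sum fun s _ =>
      pow_le_pow_left₀ (norm_nonneg _) (θ.norm_fellStar_le (k.val r s)) 2

end KernelAlgebra

/-- The envelope C*-algebra `k(B)`: the universal C*-algebra of the Banach `*`-algebra completion
of `k_c(B)`. -/
abbrev EnvelopeCStar : Type (max u v) := EnvelopingCStar (StarCompletion θ.KernelAlgebra)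

end TopologicalPartialAction

end PartialAction

/-! A pair in `R` whose group coordinates are `r⁻¹` and `s⁻¹` is determined by `r`, `s` and its
first point `x ∈ X_{rs⁻¹}`. So a function on `R` is a `G × G` matrix whose `(r, s)` entry is a
function on `X_{rs⁻¹}`, and convolution and involution become the matrix operations of the kernel
algebra. This embeds `C_c(R)` as a `*`-subalgebra of `k_c(B)` (`toKernel`). It is dense: a kernel
has finitely many nonzero entries, and each is a uniform limit of functions with compact support in
its domain (`denseRange_toKernel`).

The `I`-norm and the kernel norm differ on `C_c(R)`, but a `*`-homomorphism `π` into a C*-algebra is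
bounded by one exactly when it is bounded by the other.

If `π` is bounded by the `I`-norm, then on a single block `(r, s)` it is bounded by the supremum
norm, because a block has at most one nonzero value in each row and in each column of `R`. Blocks in
different columns of one row are orthogonal, and so are different rows; two Pythagorean inequalities
add the blocks up to the square sum that defines the kernel norm (`norm_map_le_norm_toKernel`).

If `π` is bounded by the kernel norm, fix a finite `F` and consider the functions supported on `F ×
F`. They form a `*`-subalgebra on which the kernel norm is at most `|F|` times the `I`-norm. The
C*-identity, applied to the powers `(f* f)^(2^n)`, removes the factor `|F|` (`norm_map_le_iNorm`).

Representations of the Banach `*`-algebra are contractive, so they restrict to `I`-bounded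
representations of `C_c(R)`; by density every `I`-bounded representation arises in this way. Hence
both C*-algebras are completions of `C_c(R)` for one and the same seminorm (`norm_toEnvelope`). -/

/-! ### Extension of `*`-homomorphisms from dense images -/

section DenseExtension

variable {A K T : Type*} [NonUnitalRing A] [StarRing A] [Module ℂ A]
  [NonUnitalNormedRing K] [StarRing K] [NormedStarGroup K] [NormedSpace ℂ K]
  [NonUnitalNormedRing T] [StarRing T] [NormedStarGroup T] [NormedSpace ℂ T]

/-- A `*`-homomorphism that is bounded by a `*`-homomorphism with dense range extends along it. -/
theorem NonUnitalStarAlgHom.exists_extend [CompleteSpace T] (i : A →⋆ₙₐ[ℂ] K) (hi : DenseRange i)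
    (p : A →⋆ₙₐ[ℂ] T) (hp : ∀ a, ‖p a‖ ≤ ‖i a‖) :
    ∃ q : K →⋆ₙₐ[ℂ] T, Continuous q ∧ ∀ a, q (i a) = p a := by
  let iL : A →ₗ[ℂ] K := { toFun := i, map_add' := map_add i, map_smul' := map_smul i }
  let pL : A →ₗ[ℂ] T := { toFun := p, map_add' := map_add p, map_smul' := map_smul p }
  let q : K →L[ℂ] T := pL.extendOfNorm iL
  have hq : ∀ a, q (i a) = p a := fun a =>
    LinearMap.extendOfNorm_eq (f := pL) (e := iL) hi ⟨1, fun a => (hp a).trans_eq (one_mul _).symm⟩ a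
  have hmul : ∀ x y, q (x * y) = q x * q y := fun x y => by
    refine hi.induction_on₂ (isClosed_eq (by fun_prop) (by fun_prop)) (fun a b => ?_) x y
    rw [← map_mul, hq, hq, hq, map_mul]
  have hstar : ∀ x, q (star x) = star (q x) := fun x => by
    refine hi.induction_on x (isClosed_eq (by fun_prop) (by fun_prop)) fun a => ?_
    rw [← map_star, hq, hq, map_star]
  exact ⟨{ toFun := q
           map_smul' := map_smul q
           map_zero' := map_zero q
           map_add' := map_add q
           map_mul' := hmul
           map_star' := hstar }, q.continuous, hq⟩

/-- Two completions of a `*`-algebra for the same seminorm are isomorphic. -/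
theorem NonUnitalStarAlgHom.nonempty_starAlgEquiv [CompleteSpace K] [CompleteSpace T]
    (i : A →⋆ₙₐ[ℂ] K) (hi : DenseRange i) (p : A →⋆ₙₐ[ℂ] T) (hp : DenseRange p)
    (h : ∀ a, ‖p a‖ = ‖i a‖) : Nonempty (K ≃⋆ₐ[ℂ] T) := by
  obtain ⟨q, hqc, hq⟩ := exists_extend i hi p fun a => (h a).le
  obtain ⟨q', hqc', hq'⟩ := exists_extend p hp i fun a => (h a).ge
  exact ⟨{ toFun := q
           invFun := q'
           left_inv := fun x => hi.induction_on x
             (isClosed_eq (hqc'.comp hqc) continuous_id) fun a => by rw [hq, hq']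
           right_inv := fun x => hp.induction_on x
             (isClosed_eq (hqc.comp hqc') continuous_id) fun a => by rw [hq', hq]
           map_mul' := map_mul q
           map_add' := map_add q
           map_star' := map_star q
           map_smul' := map_smul q }⟩

end DenseExtension

/-! ### Canonical maps into completions and representation C*-algebras -/

namespace StarCompletion

variable {A : Type u} [NonUnitalSeminormedRing A] [StarRing A] [NormedStarGroup A]
  [NormedSpace ℂ A]

/-- The canonical map into the completion, as a `*`-homomorphism. -/
noncomputable def ofHom : A →⋆ₙₐ[ℂ] StarCompletion A where
  toFun := of
  map_smul' := of_smul
  map_zero' := map_zero of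
  map_add' := map_add of
  map_mul' := of_mul
  map_star' := of_star

theorem norm_ofHom (a : A) : ‖(ofHom a : StarCompletion A)‖ = ‖a‖ := norm_of a

theorem denseRange_ofHom : DenseRange (ofHom : A → StarCompletion A) := isDenseInducing_of.dense

end StarCompletion

namespace RepCStar

variable {A : Type u} [NonUnitalRing A] [StarRing A] [Module ℂ A]
  (S : Set (HilbertRep A)) [PointwiseBounded S]

/-- The canonical map of a `*`-algebra into the C*-algebra of a set of representations. -/
noncomputable def ofHom : A →⋆ₙₐ[ℂ] RepCStar S :=
  (StarCompletion.ofHom (A := WithRepNorm S)).comp (WithRepNorm.of S)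

theorem norm_ofHom (a : A) : ‖ofHom S a‖ = ⨆ π : S, ‖π.1.toHom a‖ :=
  StarCompletion.norm_ofHom (A := WithRepNorm S) (WithRepNorm.of S a)

theorem denseRange_ofHom : DenseRange (ofHom S) :=
  StarCompletion.denseRange_ofHom (A := WithRepNorm S)

variable {S}

theorem le_norm_ofHom (a : A) {π : HilbertRep A} (hπ : π ∈ S) : ‖π.toHom a‖ ≤ ‖ofHom S a‖ :=
  (norm_ofHom S a).symm ▸ le_ciSup (PointwiseBounded.bdd (S := S) a) ⟨π, hπ⟩

theorem norm_ofHom_le {a : A} {c : ℝ} (hc : 0 ≤ c) (h : ∀ π ∈ S, ‖π.toHom a‖ ≤ c) :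
    ‖ofHom S a‖ ≤ c :=
  (norm_ofHom S a).symm ▸ Real.iSup_le (fun π => h π.1 π.2) hc

theorem norm_ofHom_le_of_banach {K : Type u} [NonUnitalNormedRing K] [StarRing K]
    [NormedStarGroup K] [CompleteSpace K] [NormedSpace ℂ K] [IsScalarTower ℂ K K]
    [SMulCommClass ℂ K K] (a : K) : ‖ofHom (Set.univ : Set (HilbertRep K)) a‖ ≤ ‖a‖ :=
  norm_ofHom_le (norm_nonneg a) fun π _ => π.norm_le_of_banach a

end RepCStar

/-! ### Norm inequalities from the C*-identity -/

section CStarRing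

variable {E : Type*} [NonUnitalNormedRing E] [StarRing E] [CStarRing E]

/-- Elements with orthogonal ranges satisfy a Pythagorean inequality. -/
theorem CStarRing.norm_sum_sq_le {ι : Type*} (F : Finset ι) (x : ι → E)
    (h : ∀ i ∈ F, ∀ j ∈ F, i ≠ j → star (x i) * x j = 0) :
    ‖∑ i ∈ F, x i‖ ^ 2 ≤ ∑ i ∈ F, ‖x i‖ ^ 2 := by
  -- Orthogonality kills the cross terms; the C*-identity then turns the norms of the diagonal terms
  -- into squares.
  have key : star (∑ i ∈ F, x i) * ∑ i ∈ F, x i = ∑ i ∈ F, star (x i) * x i := by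
    rw [star_sum, Finset.sum_mul]
    refine Finset.sum_congr rfl fun i hi => ?_
    rw [Finset.mul_sum]
    exact Finset.sum_eq_single_of_mem i hi fun j hj hij => h i hi j hj hij.symm
  rw [sq, ← CStarRing.norm_star_mul_self, key]
  refine (norm_sum_le _ _).trans (le_of_eq ?_)
  simp only [CStarRing.norm_star_mul_self, sq]

/-- The adjoint version of `CStarRing.norm_sum_sq_le`. -/
theorem CStarRing.norm_sum_sq_le' {ι : Type*} (F : Finset ι) (x : ι → E)
    (h : ∀ i ∈ F, ∀ j ∈ F, i ≠ j → x i * star (x j) = 0) :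
    ‖∑ i ∈ F, x i‖ ^ 2 ≤ ∑ i ∈ F, ‖x i‖ ^ 2 := by
  have := CStarRing.norm_sum_sq_le F (fun i => star (x i)) fun i hi j hj hij => by
    rw [star_star]
    exact h i hi j hj hij
  simpa only [← star_sum, norm_star] using this

/-- Taking `2^n`-th roots makes the constant `C` disappear in the limit. Equivalently, if `x / y >
1` then its powers outgrow `C`. -/
theorem le_of_forall_pow_two_pow_le {x y C : ℝ} (hy : 0 ≤ y)
    (h : ∀ n : ℕ, x ^ 2 ^ n ≤ C * y ^ 2 ^ n) : x ≤ y := by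
  by_contra! hlt
  -- For `y = 0` the quotient `x / y` is not available, but the exponent `2^0 = 1` already gives `x
  -- ≤ 0`.
  rcases hy.eq_or_lt with rfl | hy0
  · have := h 0
    simp only [pow_zero, pow_one, mul_zero] at this
    exact absurd this (not_le.2 hlt)
  · obtain ⟨n, hn⟩ := pow_unbounded_of_one_lt C ((one_lt_div hy0).2 hlt)
    have h1 := h n
    rw [← div_le_iff₀ (pow_pos hy0 _), ← div_pow] at h1
    exact absurd (hn.trans_le (pow_le_pow_right₀ ((one_lt_div hy0).2 hlt).le n.lt_two_pow_self.le))
      (not_lt.2 h1)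

/-- A `*`-homomorphism into a C*-algebra that is bounded up to a constant by a submultiplicative
function `N`, on a set that is closed under the operations, is bounded by `N` on this set. -/
theorem norm_map_le_of_submultiplicative {A : Type*} [NonUnitalRing A] [StarRing A] [Module ℂ A]
    [Module ℂ E] (π : A →⋆ₙₐ[ℂ] E) {N : A → ℝ} (hN : ∀ a, 0 ≤ N a)
    (hmul : ∀ a b, N (a * b) ≤ N a * N b) (hstar : ∀ a, N (star a) ≤ N a)
    {S : Set A} (hSmul : ∀ a ∈ S, ∀ b ∈ S, a * b ∈ S) (hSstar : ∀ a ∈ S, star a ∈ S) {C : ℝ}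
    (hC : ∀ a ∈ S, ‖π a‖ ≤ C * N a) {a : A} (ha : a ∈ S) : ‖π a‖ ≤ N a := by
  -- The element is `g = (a* a)^(2^n)`, obtained by repeated squaring. As `g` is self-adjoint, the
  -- C*-identity makes `‖π g‖` square exactly at each step, whereas `N g` is only submultiplicative;
  -- `S` is closed under the operations, so the constant `C` stays the same for all `n`.
  have key : ∀ n : ℕ, ∃ g ∈ S, star g = g ∧ N g ≤ (N a * N a) ^ 2 ^ n ∧
      ‖π g‖ = (‖π a‖ * ‖π a‖) ^ 2 ^ n := by
    intro n
    induction n with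
    | zero =>
      refine ⟨star a * a, hSmul _ (hSstar a ha) _ ha, by rw [star_mul, star_star], ?_, ?_⟩
      · rw [pow_zero, pow_one]
        exact (hmul _ _).trans (mul_le_mul_of_nonneg_right (hstar a) (hN a))
      · rw [pow_zero, pow_one, map_mul, map_star, CStarRing.norm_star_mul_self]
    | succ n ih =>
      obtain ⟨g, hg, hgs, h1, h2⟩ := ih
      refine ⟨g * g, hSmul g hg g hg, by rw [star_mul, hgs], ?_, ?_⟩
      · rw [pow_succ 2 n, pow_mul, sq]
        exact (hmul g g).trans (mul_le_mul h1 h1 (hN g) ((hN g).trans h1))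
      · have : π (g * g) = star (π g) * π g := by rw [← map_star, ← map_mul, hgs]
        rw [this, CStarRing.norm_star_mul_self, h2, pow_succ 2 n, pow_mul _ (2 ^ n), sq]
  have hsq : ‖π a‖ * ‖π a‖ ≤ N a * N a := by
    -- The sign of `C` is not known, and multiplying the bound on `N g` by the constant needs it
    -- nonnegative.
    refine le_of_forall_pow_two_pow_le (C := max C 0) (mul_self_nonneg _) fun n => ?_
    obtain ⟨g, hg, -, h1, h2⟩ := key n
    rw [← h2]
    exact (hC g hg).trans ((mul_le_mul_of_nonneg_right (le_max_left C 0) (hN g)).trans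
      (mul_le_mul_of_nonneg_left h1 (le_max_right C 0)))
  exact (mul_self_le_mul_self_iff (norm_nonneg _) (hN a)).2 hsq

end CStarRing

/-! ### The `I`-norm and the block decomposition of `C_c(R)` -/

namespace TopologicalPartialAction

variable {G : Type u} {X : Type v} [Group G] [TopologicalSpace X]
variable {θ : TopologicalPartialAction G X} [TopologicalSpace G]

namespace ConvAlgebra

theorem rel_of_ker_ne_zero {f : θ.ConvAlgebra} {a b : G × X} (h : f.ker a b ≠ 0) : θ.Rel a b := by
  by_contra hr
  exact h (ker_of_not f hr)

/-- A bound for the values of `f`. -/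
theorem exists_bound (f : θ.ConvAlgebra) : ∃ C, 0 ≤ C ∧ ∀ a b, ‖f.ker a b‖ ≤ C := by
  obtain ⟨C, hC⟩ := f.toCc.hasCompactSupport.exists_bound_of_continuous f.toCc.continuous
  refine ⟨max C 0, le_max_right _ _, fun a b => ?_⟩
  by_cases hab : θ.Rel a b
  · rw [ker_of_rel _ hab]
    exact (hC _).trans (le_max_left _ _)
  · rw [ker_of_not _ hab, norm_zero]
    exact le_max_right _ _

variable [DiscreteTopology G]

theorem rowSum_eq_sum (f : θ.ConvAlgebra) {a : G × X} {B : Finset (G × X)}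
    (hB : ∀ b, f.ker a b ≠ 0 → b ∈ B) : ∑ᶠ b, ‖f.ker a b‖ = ∑ b ∈ B, ‖f.ker a b‖ :=
  finsum_eq_sum_of_support_subset _ fun b hb => hB b (norm_ne_zero_iff.1 hb)

theorem rowSum_nonneg (f : θ.ConvAlgebra) (a : G × X) : 0 ≤ ∑ᶠ b, ‖f.ker a b‖ :=
  finsum_nonneg fun _ => norm_nonneg _

/-- The points related to `a` meet each sheet `{t} × X` at most once, and only the finitely many `t
∈ T` matter, so a row sum has at most `|T|` terms, each at most `C`. Boundedness makes the real
supremum in `rowNorm` a genuine upper bound. -/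
theorem bddAbove_rowSum (f : θ.ConvAlgebra) :
    BddAbove (Set.range fun a : G × X => ∑ᶠ b, ‖f.ker a b‖) := by
  classical
  obtain ⟨T, hT⟩ := f.exists_finset
  obtain ⟨C, hC0, hC⟩ := f.exists_bound
  refine ⟨T.card • C, ?_⟩
  rintro _ ⟨a, rfl⟩
  have hB : ∀ b, f.ker a b ≠ 0 → b ∈ T.image fun t => (t, θ.h (t⁻¹ * a.1) a.2) := fun b hb =>
    Finset.mem_image.2 ⟨b.1, hT a b hb, Prod.ext rfl (rel_of_ker_ne_zero hb).2⟩
  dsimp only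
  rw [f.rowSum_eq_sum hB]
  exact (Finset.sum_le_card_nsmul _ _ C fun b _ => hC a b).trans
    (nsmul_le_nsmul_left hC0 Finset.card_image_le)

/-- The half `sup_a ∑_b |f(a, b)|` of the `I`-norm. -/
noncomputable def rowNorm (f : θ.ConvAlgebra) : ℝ := ⨆ a : G × X, ∑ᶠ b : G × X, ‖f.ker a b‖

theorem rowNorm_nonneg (f : θ.ConvAlgebra) : 0 ≤ f.rowNorm :=
  Real.iSup_nonneg f.rowSum_nonneg

theorem rowSum_le_rowNorm (f : θ.ConvAlgebra) (a : G × X) : ∑ᶠ b, ‖f.ker a b‖ ≤ f.rowNorm :=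
  le_ciSup f.bddAbove_rowSum a

theorem norm_ker_le_rowNorm (f : θ.ConvAlgebra) (a b : G × X) : ‖f.ker a b‖ ≤ f.rowNorm := by
  classical
  obtain ⟨B, hB⟩ := f.exists_row a
  refine le_trans ?_ (f.rowSum_le_rowNorm a)
  -- Inserting `b` avoids a case distinction on whether `f.ker a b` vanishes.
  rw [f.rowSum_eq_sum (B := insert b B) fun c hc => Finset.mem_insert_of_mem (hB c hc)]
  exact Finset.single_le_sum (f := fun c => ‖f.ker a c‖) (fun c _ => norm_nonneg _)
    (Finset.mem_insert_self b B)

variable [T2Space X]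

theorem rowNorm_mul_le (f g : θ.ConvAlgebra) : (f * g).rowNorm ≤ f.rowNorm * g.rowNorm := by
  classical
  refine Real.iSup_le (fun a => ?_) (mul_nonneg f.rowNorm_nonneg g.rowNorm_nonneg)
  obtain ⟨B, hB⟩ := f.exists_row a
  choose D hD using fun b => g.exists_row b
  have h1 : ∀ b ∈ B, ∀ c, g.ker b c ≠ 0 → c ∈ B.biUnion D := fun b hb c hc =>
    Finset.mem_biUnion.2 ⟨b, hb, hD b c hc⟩
  have h2 : ∀ c, (f * g).ker a c ≠ 0 → c ∈ B.biUnion D := fun c hc => by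
    by_contra hc'
    refine hc ?_
    rw [ker_mul_eq_sum _ _ a c hB]
    refine Finset.sum_eq_zero fun b hb => ?_
    rw [not_not.1 fun h => hc' (h1 b hb c h), mul_zero]
  rw [rowSum_eq_sum _ h2]
  calc ∑ c ∈ B.biUnion D, ‖(f * g).ker a c‖
      ≤ ∑ c ∈ B.biUnion D, ∑ b ∈ B, ‖f.ker a b‖ * ‖g.ker b c‖ :=
        Finset.sum_le_sum fun c _ => by
          rw [ker_mul_eq_sum _ _ a c hB]
          exact (norm_sum_le _ _).trans (Finset.sum_le_sum fun b _ => norm_mul_le _ _)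
    _ = ∑ b ∈ B, ‖f.ker a b‖ * ∑ᶠ c, ‖g.ker b c‖ := by
        rw [Finset.sum_comm]
        refine Finset.sum_congr rfl fun b hb => ?_
        rw [g.rowSum_eq_sum (h1 b hb), Finset.mul_sum]
    _ ≤ ∑ b ∈ B, ‖f.ker a b‖ * g.rowNorm :=
        Finset.sum_le_sum fun b _ =>
          mul_le_mul_of_nonneg_left (g.rowSum_le_rowNorm b) (norm_nonneg _)
    _ = (∑ᶠ b, ‖f.ker a b‖) * g.rowNorm := by rw [f.rowSum_eq_sum hB, Finset.sum_mul]
    _ ≤ f.rowNorm * g.rowNorm :=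
        mul_le_mul_of_nonneg_right (f.rowSum_le_rowNorm a) g.rowNorm_nonneg

/-- The column sums of `f` are the row sums of `star f`, so each property of the `I`-norm needs to
be proved for rows only. -/
theorem iNorm_eq (f : θ.ConvAlgebra) : f.iNorm = max f.rowNorm (star f).rowNorm := by
  simp only [iNorm, rowNorm, ker_star, norm_star]

theorem iNorm_nonneg (f : θ.ConvAlgebra) : 0 ≤ f.iNorm :=
  f.iNorm_eq ▸ f.rowNorm_nonneg.trans (le_max_left _ _)

theorem iNorm_star (f : θ.ConvAlgebra) : (star f).iNorm = f.iNorm := by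
  rw [iNorm_eq, iNorm_eq, star_star, max_comm]

theorem iNorm_mul_le (f g : θ.ConvAlgebra) : (f * g).iNorm ≤ f.iNorm * g.iNorm := by
  rw [iNorm_eq (f * g), iNorm_eq f, iNorm_eq g, star_mul]
  refine max_le ((rowNorm_mul_le f g).trans ?_) ((rowNorm_mul_le _ _).trans ?_)
  · exact mul_le_mul (le_max_left _ _) (le_max_left _ _) g.rowNorm_nonneg
      (f.rowNorm_nonneg.trans (le_max_left _ _))
  · rw [mul_comm]
    exact mul_le_mul (le_max_right _ _) (le_max_right _ _) (rowNorm_nonneg _)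
      (f.rowNorm_nonneg.trans (le_max_left _ _))

theorem norm_ker_le_iNorm (f : θ.ConvAlgebra) (a b : G × X) : ‖f.ker a b‖ ≤ f.iNorm :=
  (f.norm_ker_le_rowNorm a b).trans (f.iNorm_eq ▸ le_max_left _ _)

/-- `f` vanishes off `(F⁻¹ × X) × (F⁻¹ × X)`. -/
def SupportedOn (f : θ.ConvAlgebra) (F : Finset G) : Prop :=
  ∀ a b, f.ker a b ≠ 0 → a.1⁻¹ ∈ F ∧ b.1⁻¹ ∈ F

theorem exists_supportedOn (f : θ.ConvAlgebra) : ∃ F : Finset G, f.SupportedOn F := by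
  classical
  obtain ⟨T, hT⟩ := f.exists_finset
  obtain ⟨T', hT'⟩ := (star f).exists_finset
  -- `T` controls the second group coordinate and `T'`, taken from `star f`, the first. The inverses
  -- match the indexing of kernels, where the point `(r⁻¹, x)` belongs to row `r`.
  refine ⟨(T ∪ T').image (·⁻¹), fun a b hab => ⟨Finset.mem_image_of_mem _ ?_,
    Finset.mem_image_of_mem _ ?_⟩⟩
  · exact Finset.mem_union_right _ (hT' b a (by rwa [ker_star, star_ne_zero]))
  · exact Finset.mem_union_left _ (hT a b hab)

theorem SupportedOn.star {f : θ.ConvAlgebra} {F : Finset G} (hf : f.SupportedOn F) :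
    (star f).SupportedOn F := fun a b h => by
  rw [ker_star, star_ne_zero] at h
  exact (hf b a h).symm

theorem SupportedOn.mul {f g : θ.ConvAlgebra} {F : Finset G} (hf : f.SupportedOn F)
    (hg : g.SupportedOn F) : (f * g).SupportedOn F := fun a c h => by
  rw [ker_mul] at h
  obtain ⟨b, hb⟩ : ∃ b, f.ker a b * g.ker b c ≠ 0 := by
    by_contra! h0
    exact h (finsum_eq_zero_of_forall_eq_zero h0)
  exact ⟨(hf a b (left_ne_zero_of_mul hb)).1, (hg b c (right_ne_zero_of_mul hb)).2⟩

/-- The restriction of `f` to the pairs `(a, b)` with `(a.1⁻¹, b.1⁻¹) ∈ A`. -/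
noncomputable def cut (A : Set (G × G)) (f : θ.ConvAlgebra) : θ.ConvAlgebra where
  toCc :=
    { toFun := fun p => A.indicator 1 (p.1.1.1⁻¹, p.1.2.1⁻¹) * f.toCc p
      continuous_toFun := by
        have h : Continuous fun p : θ.R => (p.1.1.1, p.1.2.1) :=
          ((continuous_fst.comp continuous_fst).prodMk
            (continuous_fst.comp continuous_snd)).comp continuous_subtype_val
        exact ((continuous_of_discreteTopology
          (f := fun q : G × G => A.indicator (1 : G × G → ℂ) (q.1⁻¹, q.2⁻¹))).comp h).mul
          f.toCc.continuous
      hasCompactSupport' := f.toCc.hasCompactSupport.mul_left }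

theorem ker_cut (A : Set (G × G)) (f : θ.ConvAlgebra) (a b : G × X) :
    (cut A f).ker a b = A.indicator 1 (a.1⁻¹, b.1⁻¹) * f.ker a b := by
  by_cases hab : θ.Rel a b
  · rw [ker_of_rel _ hab, ker_of_rel _ hab]; rfl
  · rw [ker_of_not _ hab, ker_of_not _ hab, mul_zero]

theorem mem_of_ker_cut_ne_zero {A : Set (G × G)} {f : θ.ConvAlgebra} {a b : G × X}
    (h : (cut A f).ker a b ≠ 0) : (a.1⁻¹, b.1⁻¹) ∈ A := by
  rw [ker_cut] at h
  exact Set.mem_of_indicator_ne_zero (left_ne_zero_of_mul h)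

theorem ker_sum {ι : Type*} (F : Finset ι) (f : ι → θ.ConvAlgebra) (a b : G × X) :
    (∑ i ∈ F, f i).ker a b = ∑ i ∈ F, (f i).ker a b :=
  map_sum (⟨⟨fun f : θ.ConvAlgebra => f.ker a b, ker_zero a b⟩, fun f g => ker_add f g a b⟩ :
    θ.ConvAlgebra →+ ℂ) f F

/-- `f` is the sum of its rows. -/
theorem eq_sum_rows {f : θ.ConvAlgebra} {F : Finset G} (hf : f.SupportedOn F) :
    f = ∑ r ∈ F, cut {p | p.1 = r} f := by
  classical
  refine ext_ker fun a b => ?_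
  simp only [ker_sum, ker_cut, Set.indicator_apply, Set.mem_ofPred_eq, Pi.one_apply, ite_mul,
    one_mul, zero_mul, Finset.sum_ite_eq]
  split_ifs with h
  · rfl
  · by_contra h0
    exact h (hf a b h0).1

/-- A row of `f` is the sum of its blocks. -/
theorem cut_eq_sum_blocks {f : θ.ConvAlgebra} {F : Finset G} (hf : f.SupportedOn F) (r : G) :
    cut {p | p.1 = r} f = ∑ s ∈ F, cut {(r, s)} f := by
  classical
  refine ext_ker fun a b => ?_
  simp only [ker_sum, ker_cut, Set.indicator_apply, Set.mem_ofPred_eq, Pi.one_apply, ite_mul,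
    one_mul, zero_mul, Set.mem_singleton_iff, Prod.mk.injEq]
  by_cases h : a.1⁻¹ = r
  · simp only [h, true_and, if_true, Finset.sum_ite_eq]
    split_ifs with h'
    · rfl
    · by_contra h0
      exact h' (hf a b h0).2
  · simp [h]

/-- In the convolution sum the middle point `b` would have to satisfy both `b.1⁻¹ = r` and `b.1⁻¹ =
r'`. This is the orthogonality used to add up the rows. -/
theorem star_row_mul_row (f : θ.ConvAlgebra) {r r' : G} (h : r ≠ r') :
    star (cut {p | p.1 = r} f) * cut {p | p.1 = r'} f = 0 := by
  refine ext_ker fun a c => ?_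
  rw [ker_mul, ker_zero, finsum_eq_zero_of_forall_eq_zero]
  intro b
  by_contra hb
  have h1 := left_ne_zero_of_mul hb
  rw [ker_star, star_ne_zero] at h1
  have h2 := mem_of_ker_cut_ne_zero h1
  have h3 := mem_of_ker_cut_ne_zero (right_ne_zero_of_mul hb)
  exact h (h2.symm.trans h3)

/-- Here the middle point would lie in both columns `s` and `s'`. This is the orthogonality used to
add up the blocks of one row. -/
theorem block_mul_star_block (f : θ.ConvAlgebra) {r s s' : G} (h : s ≠ s') :
    cut {(r, s)} f * star (cut {(r, s')} f) = 0 := by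
  refine ext_ker fun a c => ?_
  rw [ker_mul, ker_zero, finsum_eq_zero_of_forall_eq_zero]
  intro b
  by_contra hb
  have h1 := right_ne_zero_of_mul hb
  rw [ker_star, star_ne_zero] at h1
  have h2 := mem_of_ker_cut_ne_zero h1
  have h3 := mem_of_ker_cut_ne_zero (left_ne_zero_of_mul hb)
  exact h ((Prod.ext_iff.1 h3).2.symm.trans (Prod.ext_iff.1 h2).2)

/-- Each row sum has at most one nonzero term, so it is bounded by the supremum of the values. -/
theorem rowNorm_le_of_subsingleton {f : θ.ConvAlgebra} {C : ℝ} (hC : 0 ≤ C)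
    (hf : ∀ a b, ‖f.ker a b‖ ≤ C)
    (h : ∀ a b b', f.ker a b ≠ 0 → f.ker a b' ≠ 0 → b = b') : f.rowNorm ≤ C := by
  refine Real.iSup_le (fun a => ?_) hC
  by_cases h0 : ∃ b, f.ker a b ≠ 0
  · obtain ⟨b, hb⟩ := h0
    rw [finsum_eq_single _ b fun b' hb' => norm_eq_zero.2 (not_not.1 fun h' => hb' (h a b' b h' hb))]
    exact hf a b
  · push Not at h0
    simpa [h0] using hC

/-- On a block, the `I`-norm is at most the supremum norm. -/
theorem iNorm_block_le {f : θ.ConvAlgebra} {r s : G} {C : ℝ} (hC : 0 ≤ C)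
    (h : ∀ a b, a.1⁻¹ = r → b.1⁻¹ = s → ‖f.ker a b‖ ≤ C) : (cut {(r, s)} f).iNorm ≤ C := by
  have hmem : ∀ {a b}, (cut {(r, s)} f).ker a b ≠ 0 → a.1⁻¹ = r ∧ b.1⁻¹ = s := fun hab => by
    simpa using mem_of_ker_cut_ne_zero hab
  have hle : ∀ a b, ‖(cut {(r, s)} f).ker a b‖ ≤ C := fun a b => by
    by_cases h0 : (cut {(r, s)} f).ker a b = 0
    · rw [h0, norm_zero]
      exact hC
    · obtain ⟨h1, h2⟩ := hmem h0
      rw [ker_cut, h1, h2, Set.indicator_of_mem (Set.mem_singleton _), Pi.one_apply, one_mul]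
      exact h a b h1 h2
  -- The relation makes the second point a function of `a` and of the group coordinate of `b`, which
  -- is constant on a block.
  have huniq : ∀ {a b b' : G × X}, θ.Rel a b → θ.Rel a b' → b.1 = b'.1 → b = b' :=
    fun hb hb' h1 => Prod.ext h1 (by rw [← hb.2, ← hb'.2, h1])
  rw [iNorm_eq]
  refine max_le (rowNorm_le_of_subsingleton hC hle fun a b b' hb hb' => ?_)
    (rowNorm_le_of_subsingleton hC (fun a b => ?_) fun a b b' hb hb' => ?_)
  · exact huniq (rel_of_ker_ne_zero hb) (rel_of_ker_ne_zero hb')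
      (inv_injective ((hmem hb).2.trans (hmem hb').2.symm))
  · rw [ker_star, norm_star]
    exact hle b a
  · rw [ker_star, star_ne_zero] at hb hb'
    exact huniq (θ.rel_symm (rel_of_ker_ne_zero hb)) (θ.rel_symm (rel_of_ker_ne_zero hb'))
      (inv_injective ((hmem hb).1.trans (hmem hb').1.symm))

end ConvAlgebra

end TopologicalPartialAction

/-! ### The embedding of `C_c(R)` into the kernel algebra and its density -/

namespace TopologicalPartialAction

variable {G : Type u} {X : Type v} [Group G] [TopologicalSpace X]
variable {θ : TopologicalPartialAction G X}

/-- With inverted group coordinates the domain in the relation becomes `X_{rs⁻¹}`, the one that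
carries the fibre `B_{rs⁻¹}` containing `k(r, s)`. -/
theorem rel_inv_iff {r s : G} {x y : X} :
    θ.Rel (r⁻¹, x) (s⁻¹, y) ↔ x ∈ θ.dom (r * s⁻¹) ∧ θ.h (s * r⁻¹) x = y := by
  simp [Rel]

variable [TopologicalSpace G]

namespace ConvAlgebra

/-- The entries of the kernel that corresponds to `f`. -/
noncomputable def entry (f : θ.ConvAlgebra) (r s : G) (x : X) : ℂ :=
  f.ker (r⁻¹, x) (s⁻¹, θ.h (s * r⁻¹) x)

theorem entry_of_notMem (f : θ.ConvAlgebra) {r s : G} {x : X} (hx : x ∉ θ.dom (r * s⁻¹)) :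
    f.entry r s x = 0 := ker_of_not _ fun h => hx (rel_inv_iff.1 h).1

theorem ker_eq_entry (f : θ.ConvAlgebra) {a b : G × X} (hab : θ.Rel a b) :
    f.ker a b = f.entry a.1⁻¹ b.1⁻¹ a.2 := by
  obtain ⟨r, x⟩ := a
  obtain ⟨s, y⟩ := b
  have h := hab.2
  dsimp only at h
  simp [entry, h]

variable [DiscreteTopology G]

/-- The points over which the block `(r, s)` of `f` is supported. -/
def entrySupport (f : θ.ConvAlgebra) (r s : G) : Set X :=
  (fun p : θ.R => p.1.1.2) '' (tsupport f.toCc ∩ {p | p.1.1.1 = r⁻¹ ∧ p.1.2.1 = s⁻¹})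

theorem isCompact_entrySupport (f : θ.ConvAlgebra) (r s : G) :
    IsCompact (f.entrySupport r s) := by
  have c : Continuous fun p : θ.R => p.1 := continuous_subtype_val
  refine (f.toCc.hasCompactSupport.isCompact.inter_right ?_).image c.fst.snd
  exact ((isClosed_discrete {r⁻¹}).preimage c.fst.fst).inter
    ((isClosed_discrete {s⁻¹}).preimage c.snd.fst)

theorem mem_entrySupport (f : θ.ConvAlgebra) {r s : G} {x : X} (h : f.entry r s x ≠ 0) :
    x ∈ f.entrySupport r s := by
  have hr := rel_of_ker_ne_zero h
  rw [entry, ker_of_rel _ hr] at h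
  exact ⟨⟨_, hr⟩, ⟨subset_tsupport _ h, rfl, rfl⟩, rfl⟩

theorem entrySupport_subset (f : θ.ConvAlgebra) (r s : G) :
    f.entrySupport r s ⊆ θ.dom (r * s⁻¹) := by
  rintro _ ⟨⟨⟨⟨a, x⟩, ⟨b, y⟩⟩, hp⟩, ⟨-, h1, h2⟩, rfl⟩
  dsimp only at h1 h2 ⊢
  subst h1 h2
  exact (rel_inv_iff.1 hp).1

/-- This parametrizes the part of `R` over the block `(r, s)` by `X_{rs⁻¹}`. It carries continuity
from `R` to entries and compactness from `X` to `R`. -/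
theorem continuous_section (r s : G) : Continuous fun x : θ.dom (r * s⁻¹) =>
    (⟨((r⁻¹, x.1), (s⁻¹, θ.h (s * r⁻¹) x.1)), rel_inv_iff.2 ⟨x.2, rfl⟩⟩ : θ.R) := by
  have ch : Continuous fun x : θ.dom (r * s⁻¹) => θ.h (s * r⁻¹) x.1 :=
    (θ.h (s * r⁻¹)).continuousOn.comp_continuous continuous_subtype_val fun x => by
      rw [θ.source_h]
      simp
  exact ((continuous_const.prodMk continuous_subtype_val).prodMk
    (continuous_const.prodMk ch)).subtype_mk _

variable [T2Space X]

/-- The entry is continuous on the open set `X_{rs⁻¹}`. Its extension by zero stays continuous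
because the closed support lies in the compact set `entrySupport`, which is contained in that open
set. -/
theorem continuous_entry (f : θ.ConvAlgebra) (r s : G) : Continuous (f.entry r s) := by
  refine continuous_of_tsupport fun x hx => ?_
  have hx' : x ∈ θ.dom (r * s⁻¹) := f.entrySupport_subset r s
    (closure_minimal (fun x hx => f.mem_entrySupport hx)
      (f.isCompact_entrySupport r s).isClosed hx)
  refine ContinuousOn.continuousAt (s := θ.dom (r * s⁻¹)) ?_ ((θ.isOpen_dom _).mem_nhds hx')
  rw [continuousOn_iff_continuous_domRestrict]
  refine (f.toCc.continuous.comp (continuous_section r s)).congr fun x => ?_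
  exact (ker_of_rel f (rel_inv_iff.2 ⟨x.2, rfl⟩)).symm

/-- `ConvAlgebra.entry` as an element of `C₀(X)`. -/
noncomputable def entryC₀ (f : θ.ConvAlgebra) (r s : G) : C₀(X, ℂ) where
  toFun := f.entry r s
  continuous_toFun := f.continuous_entry r s
  zero_at_infty' := by
    refine tendsto_const_nhds.congr' ?_
    filter_upwards [(f.isCompact_entrySupport r s).compl_mem_cocompact] with x hx
    by_contra h
    exact hx (f.mem_entrySupport (Ne.symm h))

theorem entryC₀_apply (f : θ.ConvAlgebra) (r s : G) (x : X) :
    f.entryC₀ r s x = f.entry r s x := rfl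

theorem SupportedOn.mem_of_entryC₀_ne_zero {f : θ.ConvAlgebra} {F : Finset G}
    (hf : f.SupportedOn F) {r s : G} (h : f.entryC₀ r s ≠ 0) : r ∈ F ∧ s ∈ F := by
  obtain ⟨x, hx⟩ := DFunLike.ne_iff.1 h
  have := hf _ _ hx
  simp only [inv_inv] at this
  exact this

/-- The kernel that corresponds to `f`. -/
noncomputable def toKernelFun (f : θ.ConvAlgebra) : θ.KernelAlgebra where
  toFinsupp := Finsupp.ofSupportFinite (fun p => f.entryC₀ p.1 p.2) (by
    obtain ⟨F, hF⟩ := f.exists_supportedOn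
    refine (F ×ˢ F).finite_toSet.subset fun p hp => ?_
    rw [Finset.mem_coe, Finset.mem_product]
    exact hF.mem_of_entryC₀_ne_zero hp)
  mem_fiber r s x hx := f.entry_of_notMem hx

theorem val_toKernelFun (f : θ.ConvAlgebra) (r s : G) :
    (f.toKernelFun.val r s).1 = f.entryC₀ r s := rfl

theorem SupportedOn.toKernelFun {f : θ.ConvAlgebra} {F : Finset G} (hf : f.SupportedOn F)
    (r s : G) (h : f.toKernelFun.val r s ≠ 0) : r ∈ F ∧ s ∈ F :=
  hf.mem_of_entryC₀_ne_zero fun h0 => h (Subtype.ext h0)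

/-- The points related to `(r⁻¹, x)` are indexed by their group coordinates `t⁻¹`, so the
convolution sum over `b` becomes the matrix sum over `t`. -/
theorem toKernelFun_mul (f g : θ.ConvAlgebra) :
    (f * g).toKernelFun = f.toKernelFun * g.toKernelFun := by
  classical
  obtain ⟨F, hF⟩ := f.exists_supportedOn
  refine KernelAlgebra.ext_dom fun r s x hx => ?_
  rw [KernelAlgebra.val_mul_apply _ _ hF.toKernelFun]
  simp only [val_toKernelFun, entryC₀_apply]
  let e : G ↪ G × X := ⟨fun t => (t⁻¹, θ.h (t * r⁻¹) x), fun s t hst => by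
    simpa using congrArg Prod.fst hst⟩
  have hB : ∀ b, f.ker (r⁻¹, x) b ≠ 0 → b ∈ F.map e := fun b hb => by
    rw [Finset.mem_map]
    refine ⟨b.1⁻¹, (hF _ _ hb).2, Prod.ext (inv_inv _) ?_⟩
    exact (rel_of_ker_ne_zero hb).2
  rw [entry, ker_mul_eq_sum f g _ _ hB, Finset.sum_map]
  refine Finset.sum_congr rfl fun t _ => ?_
  change f.entry r t x * _ = _
  -- Off `X_{rt⁻¹}` the first factor vanishes on both sides. On it, the second factor is the `(t,
  -- s)` entry of `g` at the transported point, by transitivity of the relation.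
  by_cases hxt : x ∈ θ.dom (r * t⁻¹)
  · have h1 : θ.Rel (r⁻¹, x) (t⁻¹, θ.h (t * r⁻¹) x) := rel_inv_iff.2 ⟨hxt, rfl⟩
    have h2 : θ.Rel (r⁻¹, x) (s⁻¹, θ.h (s * r⁻¹) x) := rel_inv_iff.2 ⟨hx, rfl⟩
    have h3 := g.ker_eq_entry (θ.rel_trans (θ.rel_symm h1) h2)
    simp only [inv_inv] at h3
    rw [mul_inv_rev, inv_inv, ← h3]
    rfl
  · rw [f.entry_of_notMem hxt, zero_mul, zero_mul]

theorem toKernelFun_star (f : θ.ConvAlgebra) :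
    (star f).toKernelFun = star f.toKernelFun := by
  refine KernelAlgebra.ext_dom fun r s x hx => ?_
  rw [KernelAlgebra.val_star_apply _ _ _ hx]
  simp only [val_toKernelFun, entryC₀_apply]
  rw [entry, ker_star, ker_eq_entry _ (θ.rel_symm (rel_inv_iff.2 ⟨hx, rfl⟩))]
  simp only [inv_inv]

/-- The embedding of `C_c(R)` into the kernel algebra. -/
noncomputable def toKernel : θ.ConvAlgebra →⋆ₙₐ[ℂ] θ.KernelAlgebra where
  toFun := toKernelFun
  map_smul' c f := KernelAlgebra.ext_val fun _ _ _ => ker_smul c f _ _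
  map_zero' := KernelAlgebra.ext_val fun _ _ _ => ker_zero _ _
  map_add' f g := KernelAlgebra.ext_val fun _ _ _ => ker_add f g _ _
  map_mul' := toKernelFun_mul
  map_star' := toKernelFun_star

theorem norm_toKernel_sq {f : θ.ConvAlgebra} {F : Finset G} (hf : f.SupportedOn F) :
    ‖toKernel f‖ ^ 2 = ∑ r ∈ F, ∑ s ∈ F, ‖f.entryC₀ r s‖ ^ 2 :=
  KernelAlgebra.norm_sq f.toKernelFun hf.toKernelFun

theorem norm_C₀_le {g : C₀(X, ℂ)} {C : ℝ} (hC : 0 ≤ C) (h : ∀ x, ‖g x‖ ≤ C) : ‖g‖ ≤ C := by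
  rw [← ZeroAtInftyContinuousMap.norm_toBCF_eq_norm]
  exact (BoundedContinuousFunction.norm_le hC).2 h

theorem norm_entry_le (f : θ.ConvAlgebra) (r s : G) (x : X) :
    ‖f.entry r s x‖ ≤ ‖f.entryC₀ r s‖ := by
  rw [← ZeroAtInftyContinuousMap.norm_toBCF_eq_norm]
  exact (f.entryC₀ r s).toBCF.norm_coe_le_norm x

end ConvAlgebra

/-- The soft threshold, which moves every `z` by at most `ε` and vanishes for `‖z‖ < ε`. -/
noncomputable def softThreshold (ε : ℝ) (z : ℂ) : ℂ :=
  (max (‖z‖ - ε) 0 / max ‖z‖ ε : ℝ) • z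

/-- The denominator is at least `ε > 0`, so no singularity arises at `0`; it equals `‖z‖` wherever
the numerator is nonzero. -/
theorem continuous_softThreshold {ε : ℝ} (hε : 0 < ε) : Continuous (softThreshold ε) :=
  (((continuous_norm.sub continuous_const).max continuous_const).div
    (continuous_norm.max continuous_const) fun _ => (lt_max_of_lt_right hε).ne').smul continuous_id

theorem softThreshold_eq_zero {ε : ℝ} {z : ℂ} (hz : ‖z‖ ≤ ε) : softThreshold ε z = 0 := by
  rw [softThreshold, max_eq_right (sub_nonpos.2 hz), zero_div, zero_smul]

theorem norm_sub_softThreshold_le {ε : ℝ} (hε : 0 < ε) (z : ℂ) :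
    ‖z - softThreshold ε z‖ ≤ ε := by
  rcases le_total ‖z‖ ε with hz | hz
  · rwa [softThreshold_eq_zero hz, sub_zero]
  · have hz0 : 0 < ‖z‖ := hε.trans_le hz
    have h1 : z - softThreshold ε z = (ε / ‖z‖ : ℝ) • z := by
      rw [softThreshold, max_eq_left (sub_nonneg.2 hz), max_eq_left hz, sub_div, div_self hz0.ne',
        sub_smul, one_smul, sub_sub_cancel]
    rw [h1, norm_smul, Real.norm_of_nonneg (by positivity), div_mul_cancel₀ _ hz0.ne']

variable [DiscreteTopology G] [T2Space X]

namespace KernelAlgebra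

theorem isCompact_le_norm (f : C₀(X, ℂ)) {ε : ℝ} (hε : 0 < ε) : IsCompact {x | ε ≤ ‖f x‖} := by
  have hz := (zero_at_infty f).norm
  rw [norm_zero] at hz
  obtain ⟨K, hK, hKs⟩ := Filter.mem_cocompact.1 (hz (Iio_mem_nhds hε))
  refine hK.of_isClosed_subset (isClosed_le continuous_const f.continuous.norm) fun x hx => ?_
  by_contra hxK
  have h2 : ‖f x‖ < ε := hKs hxK
  exact not_le.2 h2 hx

/-- At most `|F|²` entries are nonzero, and the square root of `|F|² C²` is `|F| C`. -/
theorem norm_le_card_mul {k : θ.KernelAlgebra} {F : Finset G}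
    (hF : ∀ r s, k.val r s ≠ 0 → r ∈ F ∧ s ∈ F) {C : ℝ} (hC : 0 ≤ C)
    (h : ∀ r s x, ‖(k.val r s).1 x‖ ≤ C) : ‖k‖ ≤ F.card * C := by
  refine le_of_sq_le_sq ?_ (by positivity)
  rw [KernelAlgebra.norm_sq k hF]
  calc ∑ r ∈ F, ∑ s ∈ F, ‖(k.val r s).1‖ ^ 2 ≤ ∑ r ∈ F, ∑ s ∈ F, C ^ 2 :=
        Finset.sum_le_sum fun r _ => Finset.sum_le_sum fun s _ =>
          pow_le_pow_left₀ (norm_nonneg _) (ConvAlgebra.norm_C₀_le hC (h r s)) 2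
    _ = (F.card * C) ^ 2 := by
        simp only [Finset.sum_const, nsmul_eq_mul]
        ring

/-- The compactly supported function on `R` obtained by applying the soft threshold to a kernel. -/
noncomputable def truncate (k : θ.KernelAlgebra) {ε : ℝ} (hε : 0 < ε) : θ.ConvAlgebra where
  toCc :=
    { toFun := fun p => softThreshold ε (k.toFinsupp (p.1.1.1⁻¹, p.1.2.1⁻¹) p.1.1.2)
      continuous_toFun := by
        have c : Continuous fun p : θ.R => p.1 := continuous_subtype_val
        have h : Continuous fun q : (G × G) × X => k.toFinsupp (q.1.1⁻¹, q.1.2⁻¹) q.2 :=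
          continuous_prod_of_discrete_left.2 fun q => (k.toFinsupp (q.1⁻¹, q.2⁻¹)).continuous
        exact (continuous_softThreshold hε).comp
          (h.comp ((c.fst.fst.prodMk c.snd.fst).prodMk c.fst.snd))
      hasCompactSupport' := by
        obtain ⟨F, hF⟩ := k.exists_finset
        have hsub : ∀ r s, {x | ε ≤ ‖(k.val r s).1 x‖} ⊆ θ.dom (r * s⁻¹) := fun r s x hx => by
          by_contra h
          rw [Set.mem_ofPred_eq, θ.fiber_apply _ h, norm_zero] at hx
          exact absurd hx (not_le.2 hε)
        -- The points of `X` where the entry has modulus at least `ε` form a compact set inside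
        -- `X_{rs⁻¹}`. Its images under the sections, for `r, s ∈ F`, cover every point where the
        -- truncation is nonzero.
        have hc : ∀ r s, IsCompact ((fun x : θ.dom (r * s⁻¹) =>
            (⟨((r⁻¹, x.1), (s⁻¹, θ.h (s * r⁻¹) x.1)), rel_inv_iff.2 ⟨x.2, rfl⟩⟩ : θ.R)) ''
            (Subtype.val ⁻¹' {x | ε ≤ ‖(k.val r s).1 x‖})) := fun r s => by
          refine IsCompact.image ?_ (ConvAlgebra.continuous_section r s)
          rw [Subtype.isCompact_iff, Subtype.image_preimage_coe, Set.inter_eq_right.2 (hsub r s)]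
          exact isCompact_le_norm _ hε
        refine HasCompactSupport.intro (F.isCompact_biUnion fun r _ =>
          F.isCompact_biUnion fun s _ => hc r s) fun p hp => ?_
        by_contra h0
        obtain ⟨⟨⟨a, x⟩, ⟨b, y⟩⟩, hab⟩ := p
        dsimp only at h0
        have h1 : ε ≤ ‖(k.val a⁻¹ b⁻¹).1 x‖ := by
          by_contra h1
          exact h0 (softThreshold_eq_zero (not_le.1 h1).le)
        have h2 : k.val a⁻¹ b⁻¹ ≠ 0 := fun h2 => by
          rw [h2] at h1
          simp only [Submodule.coe_zero, ZeroAtInftyContinuousMap.coe_zero, Pi.zero_apply,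
            norm_zero] at h1
          exact absurd h1 (not_le.2 hε)
        refine hp (Set.mem_biUnion (hF _ _ h2).1 (Set.mem_biUnion (hF _ _ h2).2
          ⟨⟨x, hsub _ _ h1⟩, h1, Subtype.ext (Prod.ext (Prod.ext (inv_inv a) rfl)
            (Prod.ext (inv_inv b) ?_))⟩))
        have := hab.2
        simpa using this }

theorem entry_truncate (k : θ.KernelAlgebra) {ε : ℝ} (hε : 0 < ε) (r s : G) (x : X) :
    (k.truncate hε).entry r s x = softThreshold ε ((k.val r s).1 x) := by
  by_cases hx : x ∈ θ.dom (r * s⁻¹)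
  · rw [ConvAlgebra.entry, ConvAlgebra.ker_of_rel _ (rel_inv_iff.2 ⟨hx, rfl⟩)]
    change softThreshold ε (k.toFinsupp (r⁻¹⁻¹, s⁻¹⁻¹) x) = _
    rw [inv_inv, inv_inv]
    rfl
  · rw [ConvAlgebra.entry_of_notMem _ hx, θ.fiber_apply _ hx,
      softThreshold_eq_zero (by simpa using hε.le)]

end KernelAlgebra

/-- Soft thresholding gives every entry compact support in its domain and changes it uniformly by a
small amount. It creates no new entries, so finitely many small errors add up. -/
theorem ConvAlgebra.denseRange_toKernel :
    DenseRange (toKernel : θ.ConvAlgebra → θ.KernelAlgebra) := by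
  refine Metric.dense_iff.2 fun k ε hε => ?_
  obtain ⟨F, hF⟩ := k.exists_finset
  -- With threshold `δ = ε / (|F| + 1)` the total error `|F| δ` is strictly below `ε`, also for
  -- empty `F`.
  have hδ : 0 < ε / (F.card + 1) := by positivity
  have hval : ∀ r s x, ((k - toKernel (k.truncate hδ)).val r s).1 x =
      (k.val r s).1 x - softThreshold (ε / (F.card + 1)) ((k.val r s).1 x) := fun r s x => by
    rw [← k.entry_truncate hδ, sub_eq_add_neg, sub_eq_add_neg]
    rfl
  refine ⟨toKernel (k.truncate hδ), ?_, Set.mem_range_self _⟩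
  rw [Metric.mem_ball', dist_eq_norm]
  refine (KernelAlgebra.norm_le_card_mul (F := F) (fun r s h => hF r s fun h0 => h ?_) hδ.le
    fun r s x => ?_).trans_lt ?_
  · refine Subtype.ext (ZeroAtInftyContinuousMap.ext fun x => ?_)
    rw [hval, h0]
    simp [softThreshold]
  · rw [hval]
    exact norm_sub_softThreshold_le hδ _
  · rw [mul_div_assoc', div_lt_iff₀ (by positivity)]
    nlinarith

end TopologicalPartialAction

/-! ### Comparison of the two classes of representations and the isomorphism -/

namespace TopologicalPartialAction

variable {G : Type u} {X : Type v} [Group G] [TopologicalSpace X]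
variable {θ : TopologicalPartialAction G X}
variable [TopologicalSpace G] [DiscreteTopology G] [T2Space X]

namespace ConvAlgebra

theorem norm_toKernel_le_card_mul_iNorm {f : θ.ConvAlgebra} {F : Finset G}
    (hf : f.SupportedOn F) : ‖toKernel f‖ ≤ F.card * f.iNorm :=
  KernelAlgebra.norm_le_card_mul hf.toKernelFun f.iNorm_nonneg
    fun _ _ _ => f.norm_ker_le_iNorm _ _

/-- The `*`-representations of `C_c(R)` that are bounded by the norm of the kernel algebra are
bounded by the `I`-norm. -/
theorem norm_map_le_iNorm {E : Type*} [NonUnitalNormedRing E] [StarRing E] [CStarRing E]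
    [Module ℂ E] (π : θ.ConvAlgebra →⋆ₙₐ[ℂ] E) (hπ : ∀ f, ‖π f‖ ≤ ‖toKernel f‖)
    (f : θ.ConvAlgebra) : ‖π f‖ ≤ f.iNorm := by
  obtain ⟨F, hF⟩ := f.exists_supportedOn
  -- The constant `|F|` depends on the support, so the squaring argument runs inside the
  -- `*`-subalgebra of functions supported on this fixed `F`.
  exact norm_map_le_of_submultiplicative π iNorm_nonneg iNorm_mul_le (fun g => g.iNorm_star.le)
    (S := {g | g.SupportedOn F}) (fun _ ha _ hb => SupportedOn.mul ha hb)
    (fun _ ha => SupportedOn.star ha) (C := F.card)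
    (fun g hg => (hπ g).trans (norm_toKernel_le_card_mul_iNorm hg)) hF

/-- The `*`-representations of `C_c(R)` that are bounded by the `I`-norm are bounded by the norm
of the kernel algebra. -/
theorem norm_map_le_norm_toKernel {E : Type*} [NonUnitalNormedRing E] [StarRing E] [CStarRing E]
    [Module ℂ E] (π : θ.ConvAlgebra →⋆ₙₐ[ℂ] E) (hπ : ∀ f, ‖π f‖ ≤ f.iNorm)
    (f : θ.ConvAlgebra) : ‖π f‖ ≤ ‖toKernel f‖ := by
  obtain ⟨F, hF⟩ := f.exists_supportedOn
  have hblock : ∀ r s, ‖π (cut {(r, s)} f)‖ ≤ ‖f.entryC₀ r s‖ := fun r s =>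
    (hπ _).trans <| iNorm_block_le (norm_nonneg _) fun a b ha hb => by
      by_cases hab : θ.Rel a b
      · rw [f.ker_eq_entry hab, ha, hb]
        exact f.norm_entry_le r s a.2
      · rw [ker_of_not _ hab, norm_zero]
        exact norm_nonneg _
  -- Blocks of one row share their range index, so only the products `x y*` vanish; hence the
  -- adjoint form of the Pythagorean inequality.
  have hrow : ∀ r, ‖π (cut {p | p.1 = r} f)‖ ^ 2 ≤ ∑ s ∈ F, ‖f.entryC₀ r s‖ ^ 2 := fun r => by
    rw [cut_eq_sum_blocks hF r, map_sum]
    refine (CStarRing.norm_sum_sq_le' F _ fun s _ s' _ hs => ?_).trans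
      (Finset.sum_le_sum fun s _ => pow_le_pow_left₀ (norm_nonneg _) (hblock r s) 2)
    rw [← map_star, ← map_mul, block_mul_star_block f hs, map_zero]
  refine le_of_sq_le_sq ?_ (norm_nonneg _)
  rw [norm_toKernel_sq hF]
  conv_lhs => rw [eq_sum_rows hF, map_sum]
  -- For different rows it is the products `x* y` that vanish.
  refine (CStarRing.norm_sum_sq_le F _ fun r _ r' _ hr => ?_).trans
    (Finset.sum_le_sum fun r _ => hrow r)
  rw [← map_star, ← map_mul, star_row_mul_row f hr, map_zero]

/-- The embedding of `C_c(R)` into the Banach `*`-algebra completion of the kernel algebra. -/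
noncomputable def toCompletion : θ.ConvAlgebra →⋆ₙₐ[ℂ] StarCompletion θ.KernelAlgebra :=
  StarCompletion.ofHom.comp toKernel

theorem norm_toCompletion (f : θ.ConvAlgebra) : ‖toCompletion f‖ = ‖toKernel f‖ :=
  StarCompletion.norm_ofHom _

theorem denseRange_toCompletion :
    DenseRange (toCompletion : θ.ConvAlgebra → StarCompletion θ.KernelAlgebra) :=
  StarCompletion.denseRange_ofHom.comp denseRange_toKernel StarCompletion.continuous_of

/-- The canonical map of `C_c(R)` into the envelope C*-algebra of the Fell bundle. -/
noncomputable def toEnvelope : θ.ConvAlgebra →⋆ₙₐ[ℂ] θ.EnvelopeCStar :=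
  (RepCStar.ofHom (Set.univ : Set (HilbertRep (StarCompletion θ.KernelAlgebra)))).comp toCompletion

theorem denseRange_toEnvelope : DenseRange (toEnvelope : θ.ConvAlgebra → θ.EnvelopeCStar) := by
  let S : Set (HilbertRep (StarCompletion θ.KernelAlgebra)) := Set.univ
  refine (RepCStar.denseRange_ofHom S).comp denseRange_toCompletion ?_
  exact AddMonoidHomClass.continuous_of_bound (RepCStar.ofHom S) 1 fun k => by
    rw [one_mul]
    exact RepCStar.norm_ofHom_le_of_banach k

/-- The two suprema run over representations that correspond under restriction to `C_c(R)` and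
extension by density, so each dominates the other. -/
theorem norm_toEnvelope (f : θ.ConvAlgebra) :
    ‖toEnvelope f‖ = ‖RepCStar.ofHom θ.boundedReps f‖ := by
  refine le_antisymm (RepCStar.norm_ofHom_le (a := toCompletion f)
    (S := (Set.univ : Set (HilbertRep (StarCompletion θ.KernelAlgebra)))) (norm_nonneg _) fun ρ _ => ?_)
    (RepCStar.norm_ofHom_le (norm_nonneg _) fun π hπ => ?_)
  -- A representation of the Banach `*`-algebra is contractive, so its restriction is bounded by the
  -- kernel norm and therefore by the `I`-norm.
  · exact RepCStar.le_norm_ofHom f (π := ⟨ρ.H, ρ.toHom.comp toCompletion⟩)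
      (norm_map_le_iNorm (ρ.toHom.comp toCompletion) fun g =>
        (ρ.norm_le_of_banach (toCompletion g)).trans_eq (norm_toCompletion g))
  -- An `I`-bounded representation is bounded by the kernel norm and therefore extends to the
  -- completion.
  · obtain ⟨q, -, hq⟩ := NonUnitalStarAlgHom.exists_extend toCompletion denseRange_toCompletion
      π.toHom fun g => (norm_map_le_norm_toKernel π.toHom hπ g).trans_eq (norm_toCompletion g).symm
    rw [← hq]
    exact RepCStar.le_norm_ofHom (toCompletion f) (π := ⟨π.H, q⟩) (Set.mem_univ _)

end ConvAlgebra

end TopologicalPartialAction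

theorem mainTheorem1 {G : Type u} [Group G] [Countable G] [TopologicalSpace G] [DiscreteTopology G]
    {X : Type v} [TopologicalSpace X] [LocallyCompactSpace X] [T2Space X]
    (θ : TopologicalPartialAction G X) :
    Nonempty (θ.GroupoidCStar ≃⋆ₐ[ℂ] θ.EnvelopeCStar) :=
  NonUnitalStarAlgHom.nonempty_starAlgEquiv (RepCStar.ofHom θ.boundedReps)
    (RepCStar.denseRange_ofHom _) TopologicalPartialAction.ConvAlgebra.toEnvelope
    TopologicalPartialAction.ConvAlgebra.denseRange_toEnvelope
    TopologicalPartialAction.ConvAlgebra.norm_toEnvelope
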